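/- Let $G$ be a simple biconnected (2-connected) planar cubic graph with $2n$ vertices, embedded in the plane, and suppose that $G$ is not bipartite. Assign to each vertex $v$ a variable $\sigma(v)$ with values in $\mathbb F_3$. The main system consists of the linear equations $\sum_{v\in f}\sigma(v)=0$, one for each internal (bounded) face $f$ of $G$. For a cycle $C$ of $G$ let $V(C)$ be its vertex set, and let $V_{in}(C)$ be the set of vertices of the faces inside $C$ that are not in $V(C)$. A zebra is a vertex set obtained as follows. Take a cycle $C_0$ and pairwise disjoint cycles $C_1,\dots,C_k$ ($k\ge 0$) with $V(C_i)\subseteq V_{in}(C_0)$. Let $D$ be the domain consisting of the faces that are inside $C_0$ and not inside any of $C_1,\dots,C_k$. Choose a set $W\subseteq\bigcup_{i=0}^k V(C_i)$ that contains an even number of vertices of each $C_i$, $0\le i\le k$, and put $|W|=2m$. Take pairwise disjoint paths $P_1,\dots,P_m$, each with two distinct endpoints in $W$, whose other vertices belong to $V_{in}(C_0)\setminus\bigcup_{i=1}^k\bigl(V(C_i)\cup V_{in}(C_i)\bigr)$ and all of whose edges run in the interior of $D$ (the faces on both sides of each edge belong to $D$). The zebra is the set $\bigl(\bigcup_{i=0}^k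 V(C_i)\cup\bigcup_{j=1}^m V(P_j)\bigr)\setminus W$. Then: 1. All equations of the main system are linearly independent; that is, its rank equals $n+1$. 2. For every set $S$ of vertices, the variables $\sigma(v)$, $v\in S$, are linearly dependent (as linear functionals on the solution space of the main system) if and only if $S$ contains a zebra. 3. In particular, for any set $S$ of exactly $n$ vertices the variables $\sigma(v)$, $v\in S$, are linearly dependent, and $S$ contains a zebra. -/

import Mathlib

/-- A graph is biconnected if it has more than two vertices, is connected, and remains connected
after the deletion of any one vertex. -/
def SimpleGraph.IsBiconnected {V : Type*} (G : SimpleGraph V) : Prop :=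
  2 < Nat.card V ∧ G.Connected ∧ ∀ v : V, (G.induce ({v}ᶜ : Set V)).Connected

/-- A rotation system: a cyclic order of the darts (oriented edges) that leave each vertex.
`next d` is the dart that follows `d` in the order around the initial vertex of `d`. -/
structure RotationSystem {V : Type*} (G : SimpleGraph V) where
  next : Equiv.Perm G.Dart
  next_fst : ∀ d : G.Dart, (next d).fst = d.fst
  sameCycle_of_fst_eq : ∀ d e : G.Dart, d.fst = e.fst → next.SameCycle d e

namespace RotationSystem

variable {V : Type*} {G : SimpleGraph V} (R : RotationSystem G)

/-- The face-tracing permutation: run through the dart `d`, then leave its terminal vertex along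
the dart that follows the reversal of `d`. -/
def facePerm : Equiv.Perm G.Dart :=
  (SimpleGraph.Dart.symm_involutive (G := G)).toPerm.trans R.next

/-- Faces are the orbits of the face-tracing permutation. -/
def Face : Type _ := Quotient (Equiv.Perm.SameCycle.setoid R.facePerm)

/-- The face on a fixed side of the dart `d`. The face on the other side of the same edge is
`R.faceOf d.symm`. -/
def faceOf (d : G.Dart) : R.Face := Quotient.mk _ d

/-- The vertex `v` lies on the face `f`. -/
def Incident (v : V) (f : R.Face) : Prop := ∃ d : G.Dart, d.fst = v ∧ R.faceOf d = f

end RotationSystem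

/-- An embedding of a (connected) graph in the plane, up to homeomorphism: a rotation system of
genus zero, i.e. with `|V| - |E| + |F| = 2`, together with the choice of the external face. -/
structure PlaneEmbedding {V : Type*} (G : SimpleGraph V) extends RotationSystem G where
  euler : Nat.card V + Nat.card toRotationSystem.Face = Nat.card G.edgeSet + 2
  outer : toRotationSystem.Face

/-- A cycle of a graph. -/
structure GraphCycle {V : Type*} (G : SimpleGraph V) where
  base : V
  walk : G.Walk base base
  isCycle : walk.IsCycle

/-- A path of a graph with two distinct endpoints. -/
structure GraphPath {V : Type*} (G : SimpleGraph V) where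
  source : V
  target : V
  walk : G.Walk source target
  isPath : walk.IsPath
  source_ne_target : source ≠ target

/-- The vertex set `V(C)` of a cycle. -/
def GraphCycle.verts {V : Type*} {G : SimpleGraph V} (C : GraphCycle G) : Set V :=
  {v | v ∈ C.walk.support}

/-- The vertex set `V(P)` of a path. -/
def GraphPath.verts {V : Type*} {G : SimpleGraph V} (P : GraphPath G) : Set V :=
  {v | v ∈ P.walk.support}

namespace PlaneEmbedding

variable {V : Type*} {G : SimpleGraph V} (M : PlaneEmbedding G)

/-- Internal faces: all faces except the external one. -/
abbrev InternalFace : Type _ := {f : M.Face // f ≠ M.outer}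

/-- Two faces lie on the two sides of an edge that does not belong to the cycle `C`. -/
def AdjAvoiding (C : GraphCycle G) (f g : M.Face) : Prop :=
  ∃ d : G.Dart, d.edge ∉ C.walk.edges ∧ M.faceOf d = f ∧ M.faceOf d.symm = g

/-- The faces in the internal domain of the cycle `C`: those that cannot be joined to the external
face without crossing `C`. -/
def insideFaces (C : GraphCycle G) : Set M.Face :=
  {f | ¬ Relation.ReflTransGen (M.AdjAvoiding C) f M.outer}

/-- `V_in(C)`: the vertices of the faces inside `C`, without the vertices of `C`. -/
def insideVerts (C : GraphCycle G) : Set V :=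
  {v | v ∉ C.verts ∧ ∃ f ∈ M.insideFaces C, M.Incident v f}

/-- The data from which a zebra is built: an external cycle `C₀`, disjoint internal cycles
`C 0, …, C (k-1)` inside it, a set `W` with an even number of vertices on each cycle, and disjoint
paths that pair up the vertices of `W` and run in the domain between `C₀` and the internal cycles. -/
structure ZebraData where
  /-- the number of internal cycles -/
  k : ℕ
  /-- the number of paths -/
  m : ℕ
  C₀ : GraphCycle G
  C : Fin k → GraphCycle G
  W : Finset V
  P : Fin m → GraphPath G
  cycles_inside : ∀ i, (C i).verts ⊆ M.insideVerts C₀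
  cycles_disjoint : ∀ i j, i ≠ j → Disjoint (C i).verts (C j).verts
  W_subset : (W : Set V) ⊆ C₀.verts ∪ ⋃ i, (C i).verts
  even_W₀ : Even ((W : Set V) ∩ C₀.verts).ncard
  even_W : ∀ i, Even ((W : Set V) ∩ (C i).verts).ncard
  card_W : W.card = 2 * m
  source_mem : ∀ j, (P j).source ∈ W
  target_mem : ∀ j, (P j).target ∈ W
  paths_disjoint : ∀ i j, i ≠ j → Disjoint (P i).verts (P j).verts
  /-- apart from their endpoints, the paths pass only through vertices of the domain between `C₀`
  and the internal cycles -/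
  path_verts : ∀ j, (P j).verts ⊆
    (M.insideVerts C₀ \ ⋃ i, ((C i).verts ∪ M.insideVerts (C i))) ∪ (W : Set V)
  /-- the edges of the paths run inside this domain: it contains the faces on both of their sides
  (a path edge is neither an edge of a cycle nor a chord drawn outside the domain) -/
  path_edges : ∀ j, ∀ d ∈ (P j).walk.darts,
    M.faceOf d ∈ M.insideFaces C₀ \ ⋃ i, M.insideFaces (C i) ∧
    M.faceOf d.symm ∈ M.insideFaces C₀ \ ⋃ i, M.insideFaces (C i)

/-- The vertex set of a zebra: all vertices of the cycles and of the paths, without `W`. -/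
def ZebraData.verts {M : PlaneEmbedding G} (z : M.ZebraData) : Set V :=
  (z.C₀.verts ∪ (⋃ i, (z.C i).verts) ∪ ⋃ j, (z.P j).verts) \ (z.W : Set V)

/-- The set of vertices `Z` is a zebra. -/
def IsZebra (Z : Set V) : Prop := ∃ z : M.ZebraData, z.verts = Z

open Classical in
/-- The matrix of the main system: one row for each internal face `f`, expressing the equation
`∑ v ∈ f, σ v = 0` over the field with three elements. -/
noncomputable def mainMatrix : Matrix M.InternalFace V (ZMod 3) :=
  Matrix.of fun f v => if M.Incident v f.1 then 1 else 0

/-- The solutions of the main system. -/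
noncomputable def mainSolutions [Fintype V] : Submodule (ZMod 3) (V → ZMod 3) :=
  LinearMap.ker M.mainMatrix.mulVecLin

open Classical in
theorem mem_mainSolutions [Fintype V] (σ : V → ZMod 3) :
    σ ∈ M.mainSolutions ↔
      ∀ f : M.Face, f ≠ M.outer → ∑ v with M.Incident v f, σ v = 0 := by
  simp [mainSolutions, funext_iff, Matrix.mulVec, dotProduct, mainMatrix, Finset.sum_filter,
    InternalFace]

/-- The variable with index `v`, as a linear functional on the solutions of the main system. -/
noncomputable def mainVariable [Fintype V] (v : V) : M.mainSolutions →ₗ[ZMod 3] ZMod 3 :=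
  (LinearMap.proj v).comp M.mainSolutions.subtype

/-- The variables with indices in `S` are linearly dependent by virtue of the main system. -/
def VariablesDependent [Fintype V] (S : Set V) : Prop :=
  ¬ LinearIndependent (ZMod 3) (fun v : S => M.mainVariable v)

end PlaneEmbedding

/-! A dependence among the variables in S is a combination of face equations whose coefficients
vanish off S. Thus it is a weighting `l` of the faces by F₃, zero on the outer face, whose vertex
sums are not all zero and vanish outside S (`variablesDependent_iff`). At each vertex exactly three
distinct faces meet, and everything rests on how three elements of F₃ add up to zero: they are all
equal or all different.

Independence: if every vertex sum vanishes, the jump of `l` from a face to the next is the same all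
around a vertex and changes sign along an edge. If the jump is zero, `l` is constant, hence zero;
otherwise its sign 2-colours the graph (`eq_zero_of_faceSum_eq_zero`). Euler's formula gives n + 2
faces, so the rank is n + 1, the solution space has dimension n - 1, and any n variables are
dependent.

Zebra to dependence: because W meets each cycle evenly, the paths can be completed by arcs of the
cycles to a cycle mod 2. This bounds a set of faces, so the domain can be coloured by 1 and -1 with
a sign change exactly across the paths. Extended by 0, this weighting has vertex sum a + a + a = 0
off all cycles and paths, and 1 - 1 + 0 = 0 on W. It is nonzero, so by independence some vertex sum
is nonzero.

Dependence to zebra: cut `l` down to a dual-connected piece of its support. Edges between zero and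
nonzero faces form disjoint cycles, and edges between 1 and -1 form paths and perhaps closed curves.
By `local_structure` the sum is nonzero at a cycle vertex unless a path ends there, and at every
inner path vertex. Connectedness makes exactly one cycle enclose the support and all the other
cycles (`exists_zebraData`).

The topology used is the vanishing of the first homology of the sphere mod 2, obtained by counting
dimensions with Euler's formula. It yields the Jordan curve theorem for cycles. -/

open Finset

/-! ### Chains mod 2 and their boundaries -/

namespace SimpleGraph

variable {V : Type*} {G : SimpleGraph V}

/-- The boundary at the vertex `v` of the 1-chain `x` with coefficients in `ZMod 2`. -/
def chainBoundary [Fintype V] [DecidableEq V] [DecidableRel G.Adj] (x : Sym2 V → ZMod 2) (v : V) :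
    ZMod 2 := ∑ d : G.Dart with d.fst = v, x d.edge

/-- The 1-chain of a walk. -/
def Walk.chain [DecidableEq V] {a b : V} (p : G.Walk a b) (e : Sym2 V) : ZMod 2 :=
  (p.edges.count e : ZMod 2)

theorem Walk.chain_eq_zero [DecidableEq V] {a b : V} (p : G.Walk a b) {e : Sym2 V}
    (h : e ∉ p.edges) : p.chain e = 0 := by
  simp [Walk.chain, List.count_eq_zero_of_not_mem h]

theorem Walk.chain_eq_one [DecidableEq V] {a b : V} {p : G.Walk a b} (hp : p.IsTrail) {e : Sym2 V}
    (h : e ∈ p.edges) : p.chain e = 1 := by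
  simp [Walk.chain, List.count_eq_one_of_mem hp.edges_nodup h]

section Boundary

variable [Fintype V] [DecidableEq V] [DecidableRel G.Adj]

theorem chainBoundary_add (x y : Sym2 V → ZMod 2) (v : V) :
    G.chainBoundary (x + y) v = G.chainBoundary x v + G.chainBoundary y v := by
  simp [chainBoundary, sum_add_distrib]

theorem chainBoundary_sum {ι : Type*} (t : Finset ι) (x : ι → Sym2 V → ZMod 2) (v : V) :
    G.chainBoundary (∑ i ∈ t, x i) v = ∑ i ∈ t, G.chainBoundary (x i) v := by
  simp only [chainBoundary, Finset.sum_apply]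
  exact sum_comm

theorem chainBoundary_single {a b : V} (h : G.Adj a b) (v : V) :
    G.chainBoundary (fun e => if s(a, b) = e then 1 else 0) v =
      (if v = a then 1 else 0) + (if v = b then 1 else 0) := by
  have hab := h.ne
  have key : ∀ d : G.Dart, (s(a, b) = d.edge ↔ d = ⟨(a, b), h⟩ ∨ d = ⟨(b, a), h.symm⟩) := by
    intro d
    rw [eq_comm, show s(a, b) = (⟨(a, b), h⟩ : G.Dart).edge from rfl, dart_edge_eq_iff]
    rfl
  unfold chainBoundary
  simp only [key]
  rw [sum_filter]
  have : ∀ d : G.Dart, (if d.fst = v then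
      (if d = ⟨(a, b), h⟩ ∨ d = ⟨(b, a), h.symm⟩ then (1 : ZMod 2) else 0) else 0) =
      (if d = ⟨(a, b), h⟩ then (if v = a then 1 else 0) else 0) +
      (if d = ⟨(b, a), h.symm⟩ then (if v = b then 1 else 0) else 0) := by
    intro d
    by_cases h1 : d = ⟨(a, b), h⟩
    · subst h1
      simp [hab, eq_comm]
    · by_cases h2 : d = ⟨(b, a), h.symm⟩
      · subst h2
        simp [hab.symm, eq_comm]
      · simp [h1, h2]
  rw [sum_congr rfl (fun d _ => this d), sum_add_distrib]
  simp

theorem Walk.chainBoundary_chain {a b : V} (p : G.Walk a b) (v : V) :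
    G.chainBoundary p.chain v = (if v = a then 1 else 0) + (if v = b then 1 else 0) := by
  induction p with
  | nil => simp [chainBoundary, Walk.chain, CharTwo.add_self_eq_zero]
  | @cons a c b h p ih =>
    have : (Walk.cons h p).chain = p.chain + fun e => if s(a, c) = e then 1 else 0 := by
      funext e
      simp only [Walk.chain, Walk.edges_cons, List.count_cons, Pi.add_apply, beq_iff_eq]
      push_cast
      rfl
    rw [this, chainBoundary_add, ih, chainBoundary_single h]
    have h2 : ∀ x y z : ZMod 2, x + y + (z + x) = z + y := by decide
    exact h2 _ _ _

/-- Every vertex set with an even number of elements that are on the walk `p` is the boundary of a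
chain of edges of `p`. -/
theorem Walk.exists_chain_of_even {a b : V} (p : G.Walk a b) (T : Finset V)
    (hT : ∀ u ∈ T, u ∈ p.support) (heven : Even T.card) :
    ∃ x : Sym2 V → ZMod 2, (∀ e ∉ p.edges, x e = 0) ∧
      ∀ v, G.chainBoundary x v = if v ∈ T then 1 else 0 := by
  -- Each u in T is joined along `p` to the start `a`; the contributions at `a` cancel because T is
  -- even.
  refine ⟨∑ u ∈ T.attach, (p.takeUntil u.1 (hT _ u.2)).chain, ?_, ?_⟩
  · intro e he
    rw [Finset.sum_apply]
    exact sum_eq_zero fun u _ => Walk.chain_eq_zero _ fun h =>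
      he (p.edges_takeUntil_subset_edges _ h)
  · intro v
    rw [chainBoundary_sum]
    simp only [Walk.chainBoundary_chain]
    rw [sum_add_distrib, sum_const, card_attach, nsmul_eq_mul,
      (ZMod.natCast_eq_zero_iff_even).2 heven, zero_mul, zero_add,
      sum_attach T (fun u => if v = u then (1 : ZMod 2) else 0)]
    simp

end Boundary

end SimpleGraph

/-! ### Faces, the dual graph and homology mod 2 -/

namespace RotationSystem

variable {V : Type*} {G : SimpleGraph V} (R : RotationSystem G)

/-- The face permutation carries `d.symm` to `next d`. Hence crossing the edge of `d` is a move to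
the next corner at its initial vertex, which reduces local questions to the faces of `d`, `next d`,
`next (next d)`. -/
theorem faceOf_symm (d : G.Dart) : R.faceOf d.symm = R.faceOf (R.next d) := by
  apply Quotient.sound
  refine ⟨1, ?_⟩
  simp [facePerm]

theorem exists_faceOf_eq (f : R.Face) : ∃ d, R.faceOf d = f := Quotient.exists_rep f

instance [Finite V] : Finite R.Face := by
  classical
  have := Fintype.ofFinite V
  have : DecidableRel G.Adj := Classical.decRel _
  exact Finite.of_surjective R.faceOf R.exists_faceOf_eq

theorem eq_of_fst_eq {α : Type*} (s : G.Dart → α) (h : ∀ d, s (R.next d) = s d) {d e : G.Dart}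
    (hde : d.fst = e.fst) : s d = s e := by
  obtain ⟨i, rfl⟩ := R.sameCycle_of_fst_eq d e hde
  clear hde
  induction i using Int.induction_on with
  | zero => rfl
  | succ i ih => rw [ih, add_comm, zpow_add, zpow_one, Equiv.Perm.mul_apply, h]
  | pred i ih =>
    rw [ih]
    conv_lhs => rw [show (-(i : ℤ)) = 1 + (-(i : ℤ) - 1) by ring]
    rw [zpow_add, zpow_one, Equiv.Perm.mul_apply, h]

/-- A function on the vertices of a connected graph that takes the same values at the ends of
edges is constant. -/
theorem _root_.SimpleGraph.Connected.eq_of_adj {α : Type*} (hG : G.Connected) (s : V → α)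
    (h : ∀ u v, G.Adj u v → s u = s v) (u v : V) : s u = s v := by
  obtain ⟨p⟩ := hG.preconnected u v
  induction p with
  | nil => rfl
  | cons hadj _ ih => rw [h _ _ hadj, ih]

/-- The dual graph of a connected graph is connected. -/
theorem eq_of_faceOf_symm_eq {α : Type*} (hG : G.Connected) (s : R.Face → α)
    (h : ∀ d, s (R.faceOf d) = s (R.faceOf d.symm)) (f g : R.Face) : s f = s g := by
  have h1 : ∀ d, s (R.faceOf (R.next d)) = s (R.faceOf d) := fun d => by
    rw [← R.faceOf_symm, h d]
  have h2 : ∀ d e : G.Dart, d.fst = e.fst → s (R.faceOf d) = s (R.faceOf e) := fun d e hde =>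
    R.eq_of_fst_eq (fun d => s (R.faceOf d)) h1 hde
  have h3 : ∀ u v (p : G.Walk u v) (d e : G.Dart), d.fst = u → e.fst = v →
      s (R.faceOf d) = s (R.faceOf e) := by
    intro u v p
    induction p with
    | nil => intro d e hd he; exact h2 d e (hd.trans he.symm)
    | @cons a b c hadj p ih =>
      intro d e hd he
      rw [h2 d ⟨(a, b), hadj⟩ hd, h]
      exact ih _ e rfl he
  obtain ⟨d, rfl⟩ := R.exists_faceOf_eq f
  obtain ⟨e, rfl⟩ := R.exists_faceOf_eq g
  obtain ⟨p⟩ := hG.preconnected d.fst e.fst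
  exact h3 _ _ p d e rfl rfl

theorem _root_.SimpleGraph.exists_dart_edge_eq (e : G.edgeSet) :
    ∃ d : G.Dart, d.edge = e.1 := by
  obtain ⟨e, he⟩ := e
  induction e with
  | _ a b => exact ⟨⟨(a, b), he⟩, rfl⟩

/-- The coboundary map of the dual graph: the edges at which a set of faces changes. -/
noncomputable def dualCoboundary :
    (R.Face → ZMod 2) →ₗ[ZMod 2] (G.edgeSet → ZMod 2) where
  toFun s e := s (R.faceOf (G.exists_dart_edge_eq e).choose) +
    s (R.faceOf (G.exists_dart_edge_eq e).choose.symm)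
  map_add' x y := by ext v; simp only [Pi.add_apply]; ring
  map_smul' c x := by ext v; simp only [Pi.smul_apply, smul_eq_mul, RingHom.id_apply]; ring

theorem dualCoboundary_apply (s : R.Face → ZMod 2) (d : G.Dart) :
    R.dualCoboundary s ⟨d.edge, d.edge_mem⟩ = s (R.faceOf d) + s (R.faceOf d.symm) := by
  have h := (G.exists_dart_edge_eq ⟨d.edge, d.edge_mem⟩).choose_spec
  change s (R.faceOf (G.exists_dart_edge_eq ⟨d.edge, d.edge_mem⟩).choose) +
    s (R.faceOf (G.exists_dart_edge_eq ⟨d.edge, d.edge_mem⟩).choose.symm) = _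
  rcases (SimpleGraph.dart_edge_eq_iff _ _).1 h with h | h
  · rw [h]
  · rw [h, SimpleGraph.Dart.symm_symm, add_comm]

/-- The dual graph is connected, so the kernel of the coboundary contains only constants. -/
theorem card_face_le_finrank_range_dualCoboundary [Finite V] (hG : G.Connected) :
    Nat.card R.Face ≤ Module.finrank (ZMod 2) (LinearMap.range R.dualCoboundary) + 1 := by
  have := Fintype.ofFinite R.Face
  have h := LinearMap.finrank_range_add_finrank_ker R.dualCoboundary
  rw [Module.finrank_fintype_fun_eq_card, ← Nat.card_eq_fintype_card] at h
  have hker : LinearMap.ker R.dualCoboundary ≤ Submodule.span (ZMod 2) {fun _ => 1} := by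
    intro s hs
    rw [LinearMap.mem_ker] at hs
    have hconst := R.eq_of_faceOf_symm_eq hG s (fun d => by
      have h1 := R.dualCoboundary_apply s d
      rw [hs] at h1
      exact (CharTwo.add_eq_zero.1 h1.symm))
    rw [Submodule.mem_span_singleton]
    rcases isEmpty_or_nonempty R.Face with _ | ⟨⟨f⟩⟩
    · exact ⟨0, Subsingleton.elim _ _⟩
    · refine ⟨s f, ?_⟩
      ext g
      simp [hconst f g]
  have h1 := Submodule.finrank_mono hker
  have h2 := finrank_span_le_card (R := ZMod 2) {(fun _ => 1 : R.Face → ZMod 2)}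
  simp only [Set.toFinset_singleton, card_singleton] at h2
  omega

section Homology

variable [Fintype V] [DecidableEq V] [DecidableRel G.Adj]

/-- The boundary map of the chain complex of `G` over `ZMod 2`. -/
def _root_.SimpleGraph.boundaryMap (G : SimpleGraph V) [DecidableRel G.Adj] :
    (G.edgeSet → ZMod 2) →ₗ[ZMod 2] (V → ZMod 2) where
  toFun x v := ∑ d : G.Dart with d.fst = v, x ⟨d.edge, d.edge_mem⟩
  map_add' x y := by ext v; simp [sum_add_distrib]
  map_smul' c x := by ext v; simp [mul_sum]

/-- A walk from `a` to u has boundary a + u, so the boundaries together with the single vertex `a`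
span everything. -/
theorem _root_.SimpleGraph.Connected.card_le_finrank_range_boundaryMap (hG : G.Connected) :
    Fintype.card V ≤ Module.finrank (ZMod 2) (LinearMap.range G.boundaryMap) + 1 := by
  obtain ⟨a⟩ := hG.nonempty
  have htop : LinearMap.range G.boundaryMap ⊔
      Submodule.span (ZMod 2) {(Pi.single a 1 : V → ZMod 2)} = ⊤ := by
    rw [eq_top_iff, ← (Pi.basisFun (ZMod 2) V).span_eq, Submodule.span_le]
    rintro _ ⟨u, rfl⟩
    obtain ⟨p⟩ := hG.preconnected a u
    have h1 : G.boundaryMap (fun e => p.chain e.1) = Pi.single a 1 + Pi.single u 1 := by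
      ext v
      have := p.chainBoundary_chain v
      simp only [SimpleGraph.chainBoundary] at this
      simp only [SimpleGraph.boundaryMap, LinearMap.coe_mk, AddHom.coe_mk, this, Pi.add_apply,
        Pi.single_apply]
    have h2 : Pi.basisFun (ZMod 2) V u =
        G.boundaryMap (fun e => p.chain e.1) + (Pi.single a 1 : V → ZMod 2) := by
      rw [h1, Pi.basisFun_apply]
      ext v
      have h3 : ∀ x y : ZMod 2, y = x + y + x := by decide
      exact h3 _ _
    rw [h2]
    exact add_mem (Submodule.mem_sup_left ⟨_, rfl⟩)
      (Submodule.mem_sup_right (Submodule.mem_span_singleton_self _))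
  have h1 := Submodule.finrank_add_le_finrank_add_finrank (LinearMap.range G.boundaryMap)
    (Submodule.span (ZMod 2) {(Pi.single a 1 : V → ZMod 2)})
  rw [htop, finrank_top, Module.finrank_fintype_fun_eq_card] at h1
  have h2 := finrank_span_le_card (R := ZMod 2) {(Pi.single a 1 : V → ZMod 2)}
  simp only [Set.toFinset_singleton, card_singleton] at h2
  omega

theorem sum_next {M : Type*} [AddCommMonoid M] (v : V) (g : G.Dart → M) :
    ∑ d : G.Dart with d.fst = v, g (R.next d) = ∑ d : G.Dart with d.fst = v, g d := by
  refine sum_equiv R.next (fun d => ?_) (fun _ _ => rfl)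
  simp [R.next_fst]

/-- Around a vertex, each corner is counted once from either side, and the two contributions cancel.
-/
theorem range_dualCoboundary_le :
    LinearMap.range R.dualCoboundary ≤ LinearMap.ker G.boundaryMap := by
  rintro _ ⟨s, rfl⟩
  rw [LinearMap.mem_ker]
  ext v
  simp only [SimpleGraph.boundaryMap, LinearMap.coe_mk, AddHom.coe_mk, dualCoboundary_apply,
    faceOf_symm, sum_add_distrib]
  rw [R.sum_next v (fun d => s (R.faceOf d)), CharTwo.add_self_eq_zero, Pi.zero_apply]

end Homology

end RotationSystem

namespace PlaneEmbedding

variable {V : Type*} {G : SimpleGraph V} (M : PlaneEmbedding G)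

/-- On the sphere, every 1-cycle over `ZMod 2` is a boundary. -/
theorem exists_face_function_of_chainBoundary_eq_zero [Fintype V] [DecidableEq V]
    [DecidableRel G.Adj] (hG : G.Connected) (x : Sym2 V → ZMod 2)
    (hx : ∀ v, G.chainBoundary x v = 0) :
    ∃ s : M.Face → ZMod 2, s M.outer = 0 ∧
      ∀ d, s (M.faceOf d) + s (M.faceOf d.symm) = x d.edge := by
  have hle := M.range_dualCoboundary_le
  have h1 := M.card_face_le_finrank_range_dualCoboundary hG
  have h2 := hG.card_le_finrank_range_boundaryMap
  have h3 := LinearMap.finrank_range_add_finrank_ker G.boundaryMap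
  rw [Module.finrank_fintype_fun_eq_card, ← Nat.card_eq_fintype_card] at h3
  have h4 := M.euler
  rw [← Nat.card_eq_fintype_card] at h2
  -- Coboundaries have dimension at least |F| - 1, cycles at most |E| - |V| + 1; Euler's formula
  -- makes these equal.
  have heq := Submodule.eq_of_le_of_finrank_le hle (by omega)
  have hmem : (fun e : G.edgeSet => x e.1) ∈ LinearMap.ker G.boundaryMap := by
    rw [LinearMap.mem_ker]
    ext v
    exact hx v
  rw [← heq] at hmem
  obtain ⟨s, hs⟩ := hmem
  refine ⟨fun f => s f + s M.outer, CharTwo.add_self_eq_zero _, fun d => ?_⟩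
  have h5 := M.dualCoboundary_apply s d
  rw [hs] at h5
  have h6 : ∀ a b c : ZMod 2, a + c + (b + c) = a + b := by decide
  rw [h6, ← h5]

end PlaneEmbedding

/-! ### The three darts at a cubic vertex -/

namespace RotationSystem

variable {V : Type*} {G : SimpleGraph V} (R : RotationSystem G)
variable [Fintype V] [DecidableRel G.Adj]

/-- `next` acts transitively on the three darts at a vertex, hence as a 3-cycle. -/
theorem next_of_cubic (hcubic : G.IsRegularOfDegree 3) (d : G.Dart) :
    R.next d ≠ d ∧ R.next (R.next d) ≠ d ∧ R.next (R.next (R.next d)) = d ∧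
      ∀ e : G.Dart, e.fst = d.fst → e = d ∨ e = R.next d ∨ e = R.next (R.next d) := by
  classical
  have hcard : (univ.filter fun e : G.Dart => e.fst = d.fst).card = 3 := by
    rw [G.dart_fst_fiber_card_eq_degree, hcubic]
  have h1 : R.next d ≠ d := by
    intro h
    have hsub : (univ.filter fun e : G.Dart => e.fst = d.fst) ⊆ {d} := by
      intro e he
      rw [mem_filter] at he
      obtain ⟨i, rfl⟩ := R.sameCycle_of_fst_eq d e he.2.symm
      rw [mem_singleton]
      exact Equiv.Perm.zpow_apply_eq_self_of_apply_eq_self h i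
    have := card_le_card hsub
    simp [hcard] at this
  have h2 : R.next (R.next d) ≠ d := by
    intro h
    have hsub : (univ.filter fun e : G.Dart => e.fst = d.fst) ⊆ {d, R.next d} := by
      intro e he
      rw [mem_filter] at he
      obtain ⟨i, rfl⟩ := R.sameCycle_of_fst_eq d e he.2.symm
      rw [mem_insert, mem_singleton]
      exact Equiv.Perm.zpow_apply_eq_of_apply_apply_eq_self h i
    have := (card_le_card hsub).trans card_le_two
    omega
  have h3 : ({d, R.next d, R.next (R.next d)} : Finset G.Dart) =
      univ.filter fun e : G.Dart => e.fst = d.fst := by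
    apply eq_of_subset_of_card_le
    · intro e he
      simp only [mem_insert, mem_singleton] at he
      rcases he with rfl | rfl | rfl <;> simp [R.next_fst]
    · rw [hcard, card_eq_three.2 ⟨d, R.next d, R.next (R.next d), h1.symm, h2.symm,
        fun h => h1 (R.next.injective h).symm, rfl⟩]
  have h4 : ∀ e : G.Dart, e.fst = d.fst → e = d ∨ e = R.next d ∨ e = R.next (R.next d) := by
    intro e he
    have : e ∈ ({d, R.next d, R.next (R.next d)} : Finset G.Dart) := by
      rw [h3]; simpa using he
    simpa using this
  refine ⟨h1, h2, ?_, h4⟩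
  rcases h4 (R.next (R.next (R.next d))) (by simp [R.next_fst]) with h | h | h
  · exact h
  · exact absurd (R.next.injective h) h2
  · exact absurd (R.next.injective (R.next.injective h)) h1

theorem sum_darts_of_cubic [DecidableEq V] (hcubic : G.IsRegularOfDegree 3) {M : Type*}
    [AddCommMonoid M] (g : G.Dart → M) (d : G.Dart) :
    ∑ e : G.Dart with e.fst = d.fst, g e = g d + g (R.next d) + g (R.next (R.next d)) := by
  classical
  obtain ⟨h1, h2, -, h4⟩ := R.next_of_cubic hcubic d
  have h3 : (univ.filter fun e : G.Dart => e.fst = d.fst) =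
      ({d, R.next d, R.next (R.next d)} : Finset G.Dart) := by
    ext e
    simp only [mem_filter, mem_univ, true_and, mem_insert, mem_singleton]
    refine ⟨h4 e, ?_⟩
    rintro (rfl | rfl | rfl) <;> simp [R.next_fst]
  rw [h3, sum_insert, sum_insert, sum_singleton, add_assoc]
  · simpa using fun h => h1 (R.next.injective h).symm
  · simpa using ⟨h1.symm, h2.symm⟩

theorem ncard_of_cubic (hcubic : G.IsRegularOfDegree 3) (P : G.Dart → Prop) [DecidablePred P]
    (d : G.Dart) :
    {w | ∃ h : G.Adj d.fst w, P ⟨(d.fst, w), h⟩}.ncard = (if P d then 1 else 0) +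
      (if P (R.next d) then 1 else 0) + (if P (R.next (R.next d)) then 1 else 0) := by
  classical
  rw [← R.sum_darts_of_cubic hcubic (fun e => if P e then 1 else 0) d, ← sum_filter, sum_const,
    smul_eq_mul, mul_one, filter_filter]
  have : {w | ∃ h : G.Adj d.fst w, P ⟨(d.fst, w), h⟩} =
      (((univ.filter fun e : G.Dart => e.fst = d.fst ∧ P e).image fun e => e.snd :
        Finset V) : Set V) := by
    ext w
    simp only [Set.mem_ofPred_eq, coe_image, coe_filter, mem_univ, true_and, Set.mem_image]
    constructor
    · rintro ⟨h, hP⟩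
      exact ⟨⟨(d.fst, w), h⟩, ⟨rfl, hP⟩, rfl⟩
    · rintro ⟨⟨⟨a, b⟩, hab⟩, ⟨rfl, hP⟩, rfl⟩
      exact ⟨hab, hP⟩
  rw [this, Set.ncard_coe_finset, card_image_of_injOn]
  rintro ⟨⟨a, b⟩, hab⟩ h1 ⟨⟨a', b'⟩, hab'⟩ h2 h
  simp only [coe_filter, mem_univ, true_and, Set.mem_ofPred_eq] at h1 h2 h
  obtain ⟨rfl, -⟩ := h1
  obtain ⟨h2, -⟩ := h2
  subst h2
  subst h
  rfl

end RotationSystem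

namespace GraphCycle

variable {V : Type*} {G : SimpleGraph V} (C : GraphCycle G)

theorem fst_mem {d : G.Dart} (h : d.edge ∈ C.walk.edges) : d.fst ∈ C.verts :=
  C.walk.fst_mem_support_of_mem_edges h

theorem ncard_incident {v : V} (hv : v ∈ C.verts) :
    {w | ∃ _ : G.Adj v w, s(v, w) ∈ C.walk.edges}.ncard = 2 := by
  rw [← C.isCycle.ncard_neighborSet_toSubgraph_eq_two hv]
  congr 1
  ext w
  simp only [Set.mem_ofPred_eq, SimpleGraph.Subgraph.mem_neighborSet,
    ← SimpleGraph.Walk.mem_edges_toSubgraph, SimpleGraph.Subgraph.mem_edgeSet]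
  exact ⟨fun h => h.2, fun h => ⟨h.adj_sub, h⟩⟩

/-- In a cubic graph, exactly two of the three edges at a vertex of a cycle belong to the cycle. -/
theorem two_of_three [Fintype V] [DecidableRel G.Adj] (R : RotationSystem G)
    (hcubic : G.IsRegularOfDegree 3) {d : G.Dart} (hd : d.fst ∈ C.verts) :
    (d.edge ∉ C.walk.edges ∧ (R.next d).edge ∈ C.walk.edges ∧
      (R.next (R.next d)).edge ∈ C.walk.edges) ∨
    (d.edge ∈ C.walk.edges ∧ (R.next d).edge ∉ C.walk.edges ∧
      (R.next (R.next d)).edge ∈ C.walk.edges) ∨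
    (d.edge ∈ C.walk.edges ∧ (R.next d).edge ∈ C.walk.edges ∧
      (R.next (R.next d)).edge ∉ C.walk.edges) := by
  classical
  have h1 := C.ncard_incident hd
  have h2 := R.ncard_of_cubic hcubic (fun e => e.edge ∈ C.walk.edges) d
  have h3 : {w | ∃ h : G.Adj d.fst w, (⟨(d.fst, w), h⟩ : G.Dart).edge ∈ C.walk.edges} =
    {w | ∃ _ : G.Adj d.fst w, s(d.fst, w) ∈ C.walk.edges} := rfl
  rw [h3, h1] at h2
  by_cases ha : d.edge ∈ C.walk.edges <;> by_cases hb : (R.next d).edge ∈ C.walk.edges <;>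
    by_cases hc : (R.next (R.next d)).edge ∈ C.walk.edges <;>
    simp [ha, hb, hc] at h2 ⊢

end GraphCycle

/-! ### Inside and outside of a cycle -/

namespace PlaneEmbedding

variable {V : Type*} {G : SimpleGraph V} (M : PlaneEmbedding G)

theorem AdjAvoiding.symm {C : GraphCycle G} {f g : M.Face} (h : M.AdjAvoiding C f g) :
    M.AdjAvoiding C g f := by
  obtain ⟨d, h1, h2, h3⟩ := h
  exact ⟨d.symm, by rwa [SimpleGraph.Dart.edge_symm], h3, by rwa [SimpleGraph.Dart.symm_symm]⟩

theorem outer_notMem_insideFaces (C : GraphCycle G) : M.outer ∉ M.insideFaces C :=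
  fun h => h Relation.ReflTransGen.refl

theorem mem_insideFaces_iff_of_notMem_edges {C : GraphCycle G} {d : G.Dart}
    (h : d.edge ∉ C.walk.edges) :
    M.faceOf d ∈ M.insideFaces C ↔ M.faceOf d.symm ∈ M.insideFaces C := by
  have h1 : M.AdjAvoiding C (M.faceOf d) (M.faceOf d.symm) := ⟨d, h, rfl, rfl⟩
  exact not_congr ⟨fun h2 => Relation.ReflTransGen.head (AdjAvoiding.symm M h1) h2,
    fun h2 => Relation.ReflTransGen.head h1 h2⟩

theorem mem_insideFaces_iff_of_fst_notMem {C : GraphCycle G} {d e : G.Dart}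
    (hd : d.fst ∉ C.verts) (hde : d.fst = e.fst) :
    M.faceOf d ∈ M.insideFaces C ↔ M.faceOf e ∈ M.insideFaces C := by
  have key : ∀ d e : G.Dart, d.fst = e.fst → d.fst ∉ C.verts →
      M.faceOf d ∈ M.insideFaces C → M.faceOf e ∈ M.insideFaces C := by
    intro d e hde hd h
    have := M.eq_of_fst_eq (fun d => d.fst ∉ C.verts ∧ M.faceOf d ∈ M.insideFaces C)
      (fun d => by
        rw [← M.faceOf_symm, M.next_fst]
        exact propext (and_congr_right fun h =>
          (M.mem_insideFaces_iff_of_notMem_edges fun h' => h (C.fst_mem h')).symm)) hde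
    exact (this.mp ⟨hd, h⟩).2
  exact ⟨key d e hde hd, key e d hde.symm (hde ▸ hd)⟩

theorem faceOf_mem_of_mem_insideVerts {C : GraphCycle G} {d : G.Dart}
    (h : d.fst ∈ M.insideVerts C) : M.faceOf d ∈ M.insideFaces C := by
  obtain ⟨h1, f, hf, e, he, rfl⟩ := h
  exact (M.mem_insideFaces_iff_of_fst_notMem h1 he.symm).2 hf

/-- A dual path that reaches the outer face without crossing C₀ cannot cross C₁ either: both sides
of an edge of C₁ are inside C₀. -/
theorem insideFaces_subset {C₀ C₁ : GraphCycle G} (h : C₁.verts ⊆ M.insideVerts C₀) :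
    M.insideFaces C₁ ⊆ M.insideFaces C₀ := by
  intro f hf
  by_contra hout
  apply hf
  have h0 : Relation.ReflTransGen (M.AdjAvoiding C₀) f M.outer := not_not.1 hout
  clear hf hout
  induction h0 using Relation.ReflTransGen.head_induction_on with
  | refl => exact Relation.ReflTransGen.refl
  | head hfg hg ih =>
    refine Relation.ReflTransGen.head ?_ ih
    obtain ⟨d, hd, rfl, rfl⟩ := hfg
    refine ⟨d, fun hd1 => ?_, rfl, rfl⟩
    exact (M.mem_insideFaces_iff_of_notMem_edges hd).1
      (M.faceOf_mem_of_mem_insideVerts (h (C₁.fst_mem hd1))) hg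

variable [Fintype V] [DecidableRel G.Adj]

/-- The cycle bounds a set of faces mod 2 that omits the outer face. This set omits every face
joined to the outer one off the cycle, yet it changes across each edge of the cycle. -/
theorem not_both_outside (hG : G.Connected) {C : GraphCycle G} {d : G.Dart}
    (h : d.edge ∈ C.walk.edges) (h1 : M.faceOf d ∉ M.insideFaces C)
    (h2 : M.faceOf d.symm ∉ M.insideFaces C) : False := by
  classical
  obtain ⟨s, hs0, hs⟩ := M.exists_face_function_of_chainBoundary_eq_zero hG C.walk.chain
    (fun v => by rw [C.walk.chainBoundary_chain, CharTwo.add_self_eq_zero])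
  have key : ∀ f, f ∉ M.insideFaces C → s f = 0 := by
    intro f hf
    have hf : Relation.ReflTransGen (M.AdjAvoiding C) f M.outer := not_not.1 hf
    induction hf using Relation.ReflTransGen.head_induction_on with
    | refl => exact hs0
    | head hfg _ ih =>
      obtain ⟨e, he, rfl, rfl⟩ := hfg
      have h3 := hs e
      rw [C.walk.chain_eq_zero he] at h3
      rw [CharTwo.add_eq_zero.1 h3, ih (not_not.2 (by assumption))]
  have h3 := hs d
  rw [key _ h1, key _ h2, SimpleGraph.Walk.chain_eq_one C.isCycle.isTrail h] at h3
  simp at h3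

/-- The Jordan curve theorem for a cycle of a plane cubic graph: every edge of the cycle has one
side inside and the other side outside. -/
theorem mem_insideFaces_iff_of_mem_edges (hG : G.Connected) (hcubic : G.IsRegularOfDegree 3)
    {C : GraphCycle G} {d : G.Dart} (h : d.edge ∈ C.walk.edges) :
    M.faceOf d ∈ M.insideFaces C ↔ M.faceOf d.symm ∉ M.insideFaces C := by
  classical
  by_contra hcon
  have hd : M.faceOf d ∈ M.insideFaces C ↔ M.faceOf d.symm ∈ M.insideFaces C := by tauto
  -- A turn around a vertex crosses the cycle exactly twice and returns to its starting face. If one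
  -- of these crossings does not change sides, neither does the other; so the failure spreads along
  -- the whole cycle, and then no face at all is inside.
  have hvert : ∀ e : G.Dart, e.edge ∈ C.walk.edges →
      (M.faceOf e ∈ M.insideFaces C ↔ M.faceOf e.symm ∈ M.insideFaces C) →
      ∀ e' : G.Dart, e'.fst = e.fst →
      (M.faceOf e' ∈ M.insideFaces C ↔ M.faceOf e'.symm ∈ M.insideFaces C) := by
    intro e he hflip e' he'
    obtain ⟨-, -, h3, h4⟩ := M.next_of_cubic hcubic e
    have key := C.two_of_three M.toRotationSystem hcubic (C.fst_mem he)
    have n2 := M.mem_insideFaces_iff_of_notMem_edges (C := C) (d := M.next e)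
    have n3 := M.mem_insideFaces_iff_of_notMem_edges (C := C) (d := M.next (M.next e))
    rw [M.faceOf_symm] at hflip n2 n3
    rw [h3] at n3
    rcases h4 e' he' with rfl | rfl | rfl <;> rw [M.faceOf_symm]
    · exact hflip
    · tauto
    · rw [h3]; tauto
  have hwalk : ∀ (a b : V) (p : G.Walk a b), (∀ e ∈ p.edges, e ∈ C.walk.edges) →
      (∀ e : G.Dart, e.fst = a →
        (M.faceOf e ∈ M.insideFaces C ↔ M.faceOf e.symm ∈ M.insideFaces C)) →
      ∀ e : G.Dart, e.fst = b →
        (M.faceOf e ∈ M.insideFaces C ↔ M.faceOf e.symm ∈ M.insideFaces C) := by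
    intro a b p
    induction p with
    | nil => exact fun _ h => h
    | @cons a c b hac p ih =>
      intro hp ha
      have hac' : s(a, c) ∈ C.walk.edges := hp _ (by simp)
      refine ih (fun e he => hp e (by simp [he])) ?_
      refine hvert ⟨(c, a), hac.symm⟩ (by rwa [SimpleGraph.Dart.edge_mk, Sym2.eq_swap]) ?_
      exact (ha ⟨(a, c), hac⟩ rfl).symm
  have hd' := hvert d h hd
  have hmem : d.fst ∈ C.walk.support := C.fst_mem h
  have hbase := hwalk _ _ (C.walk.takeUntil _ hmem).reverse (fun e he => by
    rw [SimpleGraph.Walk.edges_reverse, List.mem_reverse] at he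
    exact C.walk.edges_takeUntil_subset_edges _ he) hd'
  have hall : ∀ e : G.Dart,
      (M.faceOf e ∈ M.insideFaces C ↔ M.faceOf e.symm ∈ M.insideFaces C) := by
    intro e
    by_cases he : e.edge ∈ C.walk.edges
    · exact hwalk _ _ (C.walk.takeUntil _ (C.fst_mem he))
        (fun e he => C.walk.edges_takeUntil_subset_edges _ he) hbase e rfl
    · exact M.mem_insideFaces_iff_of_notMem_edges he
  have hconst := M.eq_of_faceOf_symm_eq hG (fun f => f ∈ M.insideFaces C)
    (fun e => propext (hall e))
  have hempty : ∀ f, f ∉ M.insideFaces C := fun f hf =>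
    M.outer_notMem_insideFaces C ((hconst f M.outer).mp hf)
  exact M.not_both_outside hG h (hempty _) (hempty _)

/-- An edge of C₀ is not on C₁, so if one side were inside C₁ both would be, and both would then be
inside C₀. -/
theorem faceOf_notMem_insideFaces_of_subset (hG : G.Connected) (hcubic : G.IsRegularOfDegree 3)
    {C₀ C₁ : GraphCycle G} (h : C₁.verts ⊆ M.insideVerts C₀) {d : G.Dart}
    (hd : d.edge ∈ C₀.walk.edges) : M.faceOf d ∉ M.insideFaces C₁ := by
  intro hin
  have h1 : d.edge ∉ C₁.walk.edges := fun h1 => (h (C₁.fst_mem h1)).1 (C₀.fst_mem hd)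
  have h2 := M.insideFaces_subset h hin
  have h3 := M.insideFaces_subset h ((M.mem_insideFaces_iff_of_notMem_edges h1).1 hin)
  exact (M.mem_insideFaces_iff_of_mem_edges hG hcubic hd).1 h2 h3

/-- Deleting the initial vertex of `d` leaves a connected graph, so the edge can be completed to a
closed walk that uses it once. The set of faces bounded by this walk separates the two sides. -/
theorem faceOf_symm_ne (hcubic : G.IsRegularOfDegree 3) (hbiconn : G.IsBiconnected)
    (d : G.Dart) : M.faceOf d.symm ≠ M.faceOf d := by
  classical
  obtain ⟨-, hG, hdel⟩ := hbiconn
  have hne : (M.next d).snd ≠ d.snd := fun h =>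
    (M.next_of_cubic hcubic d).1 (SimpleGraph.Dart.ext _ _ (Prod.ext (M.next_fst d) h))
  have hadj : G.Adj d.fst (M.next d).snd := M.next_fst d ▸ (M.next d).adj
  obtain ⟨q⟩ := (hdel d.fst).preconnected ⟨d.snd, d.snd_ne_fst⟩ ⟨(M.next d).snd, hadj.ne.symm⟩
  let q' : G.Walk d.snd (M.next d).snd := q.map (SimpleGraph.Embedding.induce _).toHom
  have hq' : d.fst ∉ q'.support := by
    intro h
    have h1 : d.fst ∈ q.support.map (SimpleGraph.Embedding.induce _).toHom :=
      (SimpleGraph.Walk.support_map (SimpleGraph.Embedding.induce _).toHom q) ▸ h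
    obtain ⟨w, -, hw⟩ := List.mem_map.1 h1
    exact w.2 hw
  let p : G.Walk d.fst d.fst := .cons d.adj (q'.append (.cons hadj.symm .nil))
  obtain ⟨s, -, hs⟩ := M.exists_face_function_of_chainBoundary_eq_zero hG p.chain
    (fun v => by rw [p.chainBoundary_chain, CharTwo.add_self_eq_zero])
  intro h
  have h1 := hs d
  rw [h, CharTwo.add_self_eq_zero] at h1
  have h2 : p.edges.count d.edge = 1 := by
    have h3 : d.edge ∉ q'.edges := fun h => hq' (q'.fst_mem_support_of_mem_edges h)
    have h4 : d.edge ≠ s((M.next d).snd, d.fst) := by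
      intro h
      rcases Sym2.eq_iff.1 (show s(d.fst, d.snd) = _ from h) with h | h
      · exact hadj.ne h.1
      · exact hne h.2.symm
    simp only [p, SimpleGraph.Walk.edges_cons, SimpleGraph.Walk.edges_append,
      SimpleGraph.Walk.edges_nil, List.count_cons, List.count_append, List.count_nil,
      List.count_eq_zero_of_not_mem h3]
    simp [SimpleGraph.Dart.edge]
    simpa [SimpleGraph.Dart.edge] using h4.symm
  rw [SimpleGraph.Walk.chain, h2] at h1
  simp at h1

end PlaneEmbedding

/-! ### Face weightings, independence and rank -/

namespace PlaneEmbedding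

variable {V : Type*} {G : SimpleGraph V} (M : PlaneEmbedding G)

noncomputable instance [Finite V] : Fintype M.Face := Fintype.ofFinite _

open Classical in
/-- The sum of the weights of the faces at a vertex. -/
noncomputable def faceSum [Finite V] (l : M.Face → ZMod 3) (v : V) : ZMod 3 :=
  ∑ f with M.Incident v f, l f

/-- Extend a function on the internal faces by zero. -/
noncomputable def extendByZero (g : M.InternalFace → ZMod 3) (f : M.Face) : ZMod 3 :=
  open Classical in if h : f ≠ M.outer then g ⟨f, h⟩ else 0

theorem extendByZero_outer (g : M.InternalFace → ZMod 3) : M.extendByZero g M.outer = 0 := by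
  simp [extendByZero]

theorem extendByZero_coe (g : M.InternalFace → ZMod 3) (f : M.InternalFace) :
    M.extendByZero g f.1 = g f := by
  rw [extendByZero, dif_pos f.2]

section Finite

variable [Fintype V]

theorem sum_mul_mainMatrix (l : M.Face → ZMod 3) (hl : l M.outer = 0) (v : V)
    [Fintype M.InternalFace] :
    ∑ f : M.InternalFace, l f.1 * M.mainMatrix f v = M.faceSum l v := by
  classical
  have h1 : M.faceSum l v = ∑ f, l f * (if M.Incident v f then 1 else 0) := by
    rw [faceSum, sum_filter]
    simp
  rw [h1, ← sum_subset (subset_univ (univ.filter fun f => f ≠ M.outer))]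
  · rw [← sum_subtype_eq_sum_filter, subtype_univ]
    refine (sum_congr ?_ fun f _ => ?_)
    · ext; simp
    · simp [mainMatrix]
  · intro f _ hf
    simp only [mem_filter, mem_univ, true_and, not_not] at hf
    rw [hf, hl, zero_mul]

/-- A set of variables is dependent if and only if some combination of the equations of the main
system is nontrivial and involves only these variables. -/
theorem variablesDependent_iff (S : Set V) :
    M.VariablesDependent S ↔ ∃ l : M.Face → ZMod 3, l M.outer = 0 ∧ (∃ v, M.faceSum l v ≠ 0) ∧
      ∀ v, M.faceSum l v ≠ 0 → v ∈ S := by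
  classical
  have : Fintype M.InternalFace := Fintype.ofFinite _
  rw [VariablesDependent, Fintype.not_linearIndependent_iff]
  constructor
  · rintro ⟨g, hg, ⟨i, hi⟩⟩
    let c : V → ZMod 3 := fun v => if h : v ∈ S then g ⟨v, h⟩ else 0
    let φ : (V → ZMod 3) →ₗ[ZMod 3] ZMod 3 := ∑ v, c v • LinearMap.proj v
    -- A functional that vanishes on all solutions is a combination of the equations; the weights
    -- `l` are its coefficients.
    have hφ : φ ∈ (LinearMap.ker M.mainMatrix.mulVecLin).dualAnnihilator := by
      rw [Submodule.mem_dualAnnihilator]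
      intro σ hσ
      have h1 := LinearMap.congr_fun hg ⟨σ, hσ⟩
      simp only [LinearMap.coe_sum, Finset.sum_apply, LinearMap.smul_apply, mainVariable,
        LinearMap.comp_apply, Submodule.subtype_apply, LinearMap.proj_apply, LinearMap.zero_apply,
        smul_eq_mul] at h1
      simp only [φ, LinearMap.coe_sum, Finset.sum_apply, LinearMap.smul_apply,
        LinearMap.proj_apply, smul_eq_mul]
      rw [← h1, ← sum_subset (subset_univ (univ.filter fun v => v ∈ S)),
        ← sum_subtype_eq_sum_filter, subtype_univ]
      · exact sum_congr (by ext; simp) fun v _ => by simp [c]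
      · intro v _ hv
        simp only [mem_filter, mem_univ, true_and] at hv
        simp [c, hv]
    rw [← LinearMap.range_dualMap_eq_dualAnnihilator_ker] at hφ
    obtain ⟨ψ, hψ⟩ := hφ
    let l := M.extendByZero fun f => ψ (Pi.single f 1)
    have hsum : ∀ v, M.faceSum l v = c v := by
      intro v
      rw [← M.sum_mul_mainMatrix l (M.extendByZero_outer _)]
      have h1 : φ (Pi.single v 1) = c v := by
        simp [φ, LinearMap.coe_sum, Finset.sum_apply, Pi.single_apply]
      rw [← h1, ← hψ, LinearMap.dualMap_apply]
      have h2 : M.mainMatrix.mulVecLin (Pi.single v 1) =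
          ∑ f, M.mainMatrix f v • (Pi.single f 1 : M.InternalFace → ZMod 3) := by
        ext f
        simp [Finset.sum_apply, Pi.single_apply]
      rw [h2, map_sum]
      refine sum_congr rfl fun f _ => ?_
      rw [map_smul, smul_eq_mul, mul_comm, show l f.1 = _ from M.extendByZero_coe _ f]
    refine ⟨l, M.extendByZero_outer _, ⟨i.1, ?_⟩, fun v hv => ?_⟩
    · rw [hsum]; simpa [c] using hi
    · rw [hsum] at hv
      by_contra h
      simp [c, h] at hv
  · rintro ⟨l, hl, ⟨v₀, hv₀⟩, hS⟩
    refine ⟨fun v => M.faceSum l v.1, ?_, ⟨v₀, hS _ hv₀⟩, hv₀⟩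
    ext ⟨σ, hσ⟩
    simp only [LinearMap.coe_sum, Finset.sum_apply, LinearMap.smul_apply, mainVariable,
        LinearMap.comp_apply, Submodule.subtype_apply, LinearMap.proj_apply, LinearMap.zero_apply,
        smul_eq_mul]
    have h1 : ∑ v : S, M.faceSum l v.1 * σ v.1 = ∑ v, M.faceSum l v * σ v := by
      rw [← sum_subset (subset_univ (univ.filter fun v => v ∈ S)),
        ← sum_subtype_eq_sum_filter, subtype_univ]
      intro v _ hv
      simp only [mem_filter, mem_univ, true_and] at hv
      rw [not_not.1 (mt (hS v) hv), zero_mul]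
    rw [h1]
    simp only [← M.sum_mul_mainMatrix l hl, sum_mul]
    rw [sum_comm]
    refine sum_eq_zero fun f _ => ?_
    have h2 := congrFun (LinearMap.mem_ker.1 hσ) f
    simp only [Matrix.mulVecLin_apply, Matrix.mulVec, dotProduct, Pi.zero_apply] at h2
    simp only [mul_assoc, ← mul_sum, h2, mul_zero]

end Finite

section Cubic

variable [Fintype V] [DecidableRel G.Adj]

/-- Any two of the three corners at a cubic vertex lie on the two sides of an edge, so the three
faces are distinct and none is counted twice. -/
theorem faceSum_eq (hcubic : G.IsRegularOfDegree 3) (hbiconn : G.IsBiconnected)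
    (l : M.Face → ZMod 3) (d : G.Dart) :
    M.faceSum l d.fst = l (M.faceOf d) + l (M.faceOf (M.next d)) +
      l (M.faceOf (M.next (M.next d))) := by
  classical
  obtain ⟨-, -, h3, h4⟩ := M.next_of_cubic hcubic d
  have n1 := M.faceOf_symm_ne hcubic hbiconn d
  have n2 := M.faceOf_symm_ne hcubic hbiconn (M.next d)
  have n3 := M.faceOf_symm_ne hcubic hbiconn (M.next (M.next d))
  rw [M.faceOf_symm] at n1 n2 n3
  rw [h3] at n3
  have h5 : (univ.filter fun f => M.Incident d.fst f) =
      {M.faceOf d, M.faceOf (M.next d), M.faceOf (M.next (M.next d))} := by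
    ext f
    simp only [mem_filter, mem_univ, true_and, mem_insert, mem_singleton]
    constructor
    · rintro ⟨e, he, rfl⟩
      rcases h4 e he with rfl | rfl | rfl <;> simp
    · rintro (rfl | rfl | rfl)
      · exact ⟨_, rfl, rfl⟩
      · exact ⟨_, M.next_fst d, rfl⟩
      · exact ⟨_, (M.next_fst _).trans (M.next_fst d), rfl⟩
  rw [faceSum, h5, sum_insert, sum_insert, sum_singleton, add_assoc]
  · simpa using n2.symm
  · simpa using ⟨n1.symm, n3⟩

/-- The equations of the main system are independent: a face weighting with zero vertex sums is
constant, or else its variation along the darts at a vertex yields a 2-colouring. -/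
theorem eq_zero_of_faceSum_eq_zero (hcubic : G.IsRegularOfDegree 3) (hbiconn : G.IsBiconnected)
    (hnonbip : ¬ G.IsBipartite) (l : M.Face → ZMod 3) (hl : l M.outer = 0)
    (h : ∀ v, M.faceSum l v = 0) : l = 0 := by
  have hG := hbiconn.2.1
  -- A zero sum of three elements of F₃ makes them an arithmetic progression, so the jump `t` is
  -- constant around each vertex.
  let t : G.Dart → ZMod 3 := fun d => l (M.faceOf d.symm) - l (M.faceOf d)
  have ht : ∀ d, t (M.next d) = t d := by
    intro d
    have h1 := M.faceSum_eq hcubic hbiconn l d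
    rw [h] at h1
    simp only [t, M.faceOf_symm]
    generalize l (M.faceOf d) = a, l (M.faceOf (M.next d)) = b,
      l (M.faceOf (M.next (M.next d))) = c at h1 ⊢
    revert a b c
    decide
  have ht' : ∀ d : G.Dart, t d.symm = - t d := fun d => by simp [t]
  have hvert : ∀ d e : G.Dart, d.fst = e.fst → t d = t e := fun d e => M.eq_of_fst_eq t ht
  by_cases h0 : ∀ d, t d = 0
  · ext f
    rw [M.eq_of_faceOf_symm_eq hG l (fun d => (sub_eq_zero.1 (h0 d)).symm) f M.outer, hl]
    rfl
  · exfalso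
    push Not at h0
    obtain ⟨d₀, hd₀⟩ := h0
    have hex : ∀ v, ∃ d : G.Dart, d.fst = v := by
      intro v
      have : 0 < G.degree v := by rw [hcubic]; norm_num
      obtain ⟨w, hw⟩ := (G.degree_pos_iff_exists_adj v).1 this
      exact ⟨⟨(v, w), hw⟩, rfl⟩
    choose D hD using hex
    have hstep : ∀ u v, G.Adj u v → t (D u) = - t (D v) := by
      intro u v huv
      rw [hvert (D u) ⟨(u, v), huv⟩ (hD u), hvert (D v) ⟨(v, u), huv.symm⟩ (hD v), ← ht']
      rfl
    have hne : ∀ v, t (D v) ≠ 0 := by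
      intro v
      have := hG.eq_of_adj (fun v => t (D v) = 0) (fun u v huv => by
        simp [hstep u v huv]) v d₀.fst
      rw [ne_eq, this, hvert (D d₀.fst) d₀ (hD _)]
      exact hd₀
    apply hnonbip
    refine ⟨SimpleGraph.Coloring.mk (fun v => if t (D v) = 1 then 0 else 1) ?_⟩
    intro u v huv
    have h1 := hstep u v huv
    have h2 := hne v
    generalize t (D u) = a, t (D v) = b at h1 h2 ⊢
    revert a b
    decide

theorem linearIndependent_mainMatrix_row (hcubic : G.IsRegularOfDegree 3)
    (hbiconn : G.IsBiconnected) (hnonbip : ¬ G.IsBipartite) :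
    LinearIndependent (ZMod 3) M.mainMatrix.row := by
  have : Fintype M.InternalFace := Fintype.ofFinite _
  rw [Fintype.linearIndependent_iff]
  intro g hg f
  rw [← M.extendByZero_coe g f, M.eq_zero_of_faceSum_eq_zero hcubic hbiconn hnonbip _
    (M.extendByZero_outer g)]
  · rfl
  · intro v
    rw [← M.sum_mul_mainMatrix _ (M.extendByZero_outer g)]
    have := congrFun hg v
    simpa [Finset.sum_apply, M.extendByZero_coe] using this

theorem rank_mainMatrix {n : ℕ} (hcard : Fintype.card V = 2 * n)
    (hcubic : G.IsRegularOfDegree 3) (hbiconn : G.IsBiconnected) (hnonbip : ¬ G.IsBipartite) :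
    M.mainMatrix.rank = n + 1 := by
  classical
  have : Fintype M.InternalFace := Fintype.ofFinite _
  rw [(M.linearIndependent_mainMatrix_row hcubic hbiconn hnonbip).rank_matrix]
  have h1 := M.euler
  -- There are 3n edges, so Euler's formula leaves n + 2 faces, one of which is external.
  have h2 := G.sum_degrees_eq_twice_card_edges
  simp only [hcubic.degree_eq, sum_const, card_univ, hcard, smul_eq_mul] at h2
  rw [Nat.card_eq_fintype_card, hcard, Nat.card_eq_fintype_card, Nat.card_eq_fintype_card,
    ← SimpleGraph.edgeFinset_card] at h1
  have h3 : Fintype.card M.InternalFace = Fintype.card M.Face - 1 := by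
    rw [Fintype.card_subtype_compl, Fintype.card_subtype_eq]
  omega

theorem variablesDependent_of_ncard_eq {n : ℕ} (hcard : Fintype.card V = 2 * n)
    (hcubic : G.IsRegularOfDegree 3) (hbiconn : G.IsBiconnected) (hnonbip : ¬ G.IsBipartite)
    (S : Set V) (hS : S.ncard = n) : M.VariablesDependent S := by
  classical
  intro h
  have h1 := h.fintype_card_le_finrank
  have h2 := LinearMap.finrank_range_add_finrank_ker M.mainMatrix.mulVecLin
  have h3 := M.rank_mainMatrix hcard hcubic hbiconn hnonbip
  rw [Module.finrank_fintype_fun_eq_card, hcard] at h2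
  rw [Matrix.rank] at h3
  have h4 : Module.finrank (ZMod 3) (M.mainSolutions →ₗ[ZMod 3] ZMod 3) =
    Module.finrank (ZMod 3) M.mainSolutions := Subspace.dual_finrank_eq
  rw [h4, mainSolutions, ← Nat.card_eq_fintype_card, Nat.card_coe_set_eq, hS] at h1
  omega

end Cubic

end PlaneEmbedding

/-! ### From a zebra to a dependence -/

namespace GraphPath

variable {V : Type*} {G : SimpleGraph V} (P : GraphPath G)

theorem exists_dart_fst_eq {v : V} (hv : v ∈ P.verts) :
    ∃ d : G.Dart, d.fst = v ∧ d.edge ∈ P.walk.edges := by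
  have hnil : ¬ P.walk.Nil := SimpleGraph.Walk.not_nil_of_ne P.source_ne_target
  obtain ⟨e, he, hve⟩ :=
    (SimpleGraph.Walk.mem_support_iff_exists_mem_edges_of_not_nil hnil).1 hv
  obtain ⟨w, rfl⟩ := Sym2.mem_iff_exists.1 hve
  exact ⟨⟨(v, w), P.walk.edges_subset_edgeSet he⟩, rfl, he⟩

theorem fst_mem {d : G.Dart} (h : d.edge ∈ P.walk.edges) : d.fst ∈ P.verts :=
  P.walk.fst_mem_support_of_mem_edges h

end GraphPath

namespace PlaneEmbedding.ZebraData

variable {V : Type*} {G : SimpleGraph V} {M : PlaneEmbedding G} (z : M.ZebraData)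

/-- The external and the internal cycles of a zebra, as one family. -/
def cycle : Option (Fin z.k) → GraphCycle G
  | none => z.C₀
  | some i => z.C i

/-- The domain between the external and the internal cycles. -/
def domain : Set M.Face := M.insideFaces z.C₀ \ ⋃ i, M.insideFaces (z.C i)

theorem cycle_disjoint {i j : Option (Fin z.k)} (h : i ≠ j) :
    Disjoint (z.cycle i).verts (z.cycle j).verts := by
  have h0 : ∀ i, Disjoint z.C₀.verts (z.C i).verts := fun i =>
    Set.disjoint_left.2 fun v hv hv' => (z.cycles_inside i hv').1 hv
  match i, j, h with
  | none, none, h => exact absurd rfl h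
  | none, some j, _ => exact h0 j
  | some i, none, _ => exact (h0 i).symm
  | some i, some j, h => exact z.cycles_disjoint i j fun hij => h (congrArg _ hij)

theorem exists_mem_cycle {v : V} (hv : v ∈ z.W) : ∃ i, v ∈ (z.cycle i).verts := by
  rcases z.W_subset hv with h | h
  · exact ⟨none, h⟩
  · obtain ⟨i, hi⟩ := Set.mem_iUnion.1 h
    exact ⟨some i, hi⟩

theorem even_card_cycle (i : Option (Fin z.k)) [DecidablePred (· ∈ (z.cycle i).verts)] :
    Even (z.W.filter (· ∈ (z.cycle i).verts)).card := by
  have h : ((z.W : Set V) ∩ (z.cycle i).verts).ncard =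
      (z.W.filter (· ∈ (z.cycle i).verts)).card := by
    rw [← Set.ncard_coe_finset]
    congr 1
    ext v
    simp
  rw [← h]
  match i with
  | none => exact z.even_W₀
  | some i => exact z.even_W i

/-- The ends of the paths of a zebra. -/
def pathEnd (p : Fin z.m × Bool) : V := if p.2 then (z.P p.1).target else (z.P p.1).source

theorem pathEnd_mem (p : Fin z.m × Bool) : z.pathEnd p ∈ (z.P p.1).verts := by
  unfold pathEnd
  split
  · exact SimpleGraph.Walk.end_mem_support _
  · exact SimpleGraph.Walk.start_mem_support _

theorem eq_of_mem_path {i j : Fin z.m} {v : V} (hi : v ∈ (z.P i).verts)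
    (hj : v ∈ (z.P j).verts) : i = j := by
  by_contra h
  exact Set.disjoint_left.1 (z.paths_disjoint i j h) hi hj

theorem pathEnd_injective : Function.Injective z.pathEnd := by
  rintro ⟨i, a⟩ ⟨j, b⟩ h
  have hij : i = j := z.eq_of_mem_path (z.pathEnd_mem (i, a)) (h ▸ z.pathEnd_mem (j, b))
  subst hij
  have := (z.P i).source_ne_target
  cases a <;> cases b <;> simp_all [pathEnd, eq_comm]

/-- The 2m path ends are distinct and lie in W, which has 2m elements; hence each vertex of W ends
exactly one path. -/
theorem image_pathEnd [DecidableEq V] : univ.image z.pathEnd = z.W := by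
  apply eq_of_subset_of_card_le
  · rintro v hv
    obtain ⟨p, -, rfl⟩ := mem_image.1 hv
    unfold pathEnd
    split
    · exact z.target_mem _
    · exact z.source_mem _
  · rw [card_image_of_injective _ z.pathEnd_injective, z.card_W]
    simp [mul_comm]

theorem mem_domain_iff {d : G.Dart} (h : ∀ i, d.edge ∉ (z.cycle i).walk.edges) :
    M.faceOf d ∈ z.domain ↔ M.faceOf d.symm ∈ z.domain := by
  have h0 := M.mem_insideFaces_iff_of_notMem_edges (h none)
  have h1 := fun i => M.mem_insideFaces_iff_of_notMem_edges (h (some i))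
  simp only [cycle] at h0 h1
  simp only [domain, Set.mem_sdiff, Set.mem_iUnion, h0, h1]

theorem path_edge_mem_domain {d : G.Dart} {j : Fin z.m} (h : d.edge ∈ (z.P j).walk.edges) :
    M.faceOf d ∈ z.domain ∧ M.faceOf d.symm ∈ z.domain := by
  obtain ⟨e, he, hed⟩ := List.mem_map.1 h
  have h1 := z.path_edges j e he
  rcases (SimpleGraph.dart_edge_eq_iff _ _).1 hed with rfl | rfl
  · exact h1
  · rw [SimpleGraph.Dart.symm_symm] at h1
    exact h1.symm

variable [Fintype V] [DecidableRel G.Adj]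

/-- The domain of a zebra is cut by the paths into two classes of regions. -/
theorem exists_face_function (hG : G.Connected) :
    ∃ s : M.Face → ZMod 2,
      (∀ d : G.Dart, (∀ i, d.edge ∉ (z.cycle i).walk.edges) →
        (∀ j, d.edge ∉ (z.P j).walk.edges) → s (M.faceOf d) = s (M.faceOf d.symm)) ∧
      ∀ d : G.Dart, (∀ i, d.edge ∉ (z.cycle i).walk.edges) →
        (∃ j, d.edge ∈ (z.P j).walk.edges) → s (M.faceOf d) ≠ s (M.faceOf d.symm) := by
  classical
  -- The arcs `y i` on the cycles have the same total boundary W as the paths, so arcs and paths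
  -- together bound a set of faces.
  have hy := fun i => (z.cycle i).walk.exists_chain_of_even
    (z.W.filter (· ∈ (z.cycle i).verts)) (fun u hu => (mem_filter.1 hu).2) (z.even_card_cycle i)
  choose y hy0 hy1 using hy
  have hpath : ∀ v, ∑ j, G.chainBoundary (z.P j).walk.chain v = if v ∈ z.W then 1 else 0 := by
    intro v
    rw [← z.image_pathEnd]
    have h1 : ∑ j, G.chainBoundary (z.P j).walk.chain v =
        ∑ p, if v = z.pathEnd p then (1 : ZMod 2) else 0 := by
      rw [Fintype.sum_prod_type]
      refine sum_congr rfl fun j _ => ?_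
      rw [SimpleGraph.Walk.chainBoundary_chain]
      rw [Fintype.sum_bool, add_comm]
      rfl
    rw [h1, ← sum_image (f := fun w => if v = w then (1 : ZMod 2) else 0)
      z.pathEnd_injective.injOn]
    simp
  have hcycle : ∀ v, ∑ i, G.chainBoundary (y i) v = if v ∈ z.W then 1 else 0 := by
    intro v
    simp only [hy1, mem_filter]
    by_cases hv : v ∈ z.W
    · obtain ⟨i, hi⟩ := z.exists_mem_cycle hv
      rw [sum_eq_single i]
      · simp [hv, hi]
      · intro j _ hji
        rw [if_neg]
        exact fun h => Set.disjoint_left.1 (z.cycle_disjoint hji) h.2 hi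
      · simp
    · simp [hv]
  obtain ⟨s, -, hs⟩ := M.exists_face_function_of_chainBoundary_eq_zero hG
    (∑ j, (z.P j).walk.chain + ∑ i, y i) (fun v => by
      rw [SimpleGraph.chainBoundary_add, SimpleGraph.chainBoundary_sum,
        SimpleGraph.chainBoundary_sum, hpath, hcycle, CharTwo.add_self_eq_zero])
  have hx : ∀ d : G.Dart, (∀ i, d.edge ∉ (z.cycle i).walk.edges) →
      s (M.faceOf d) + s (M.faceOf d.symm) = ∑ j, (z.P j).walk.chain d.edge := by
    intro d hd
    rw [hs, Pi.add_apply, Finset.sum_apply, Finset.sum_apply,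
      sum_eq_zero fun i _ => hy0 i _ (hd i), add_zero]
  refine ⟨s, fun d hd hP => ?_, fun d hd hP => ?_⟩
  · have h1 := hx d hd
    rw [sum_eq_zero fun j _ => (z.P j).walk.chain_eq_zero (hP j)] at h1
    exact CharTwo.add_eq_zero.1 h1
  · intro h
    have h1 := hx d hd
    obtain ⟨j, hj⟩ := hP
    rw [h, CharTwo.add_self_eq_zero, sum_eq_single j,
      SimpleGraph.Walk.chain_eq_one (z.P j).isPath.isTrail hj] at h1
    · simp at h1
    · intro i _ hij
      apply SimpleGraph.Walk.chain_eq_zero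
      exact fun hi => hij (z.eq_of_mem_path ((z.P i).fst_mem hi) ((z.P j).fst_mem hj))
    · simp

theorem notMem_domain_of_mem_cycle (hG : G.Connected) (hcubic : G.IsRegularOfDegree 3)
    {d : G.Dart} {i : Option (Fin z.k)} (h : d.edge ∈ (z.cycle i).walk.edges)
    (hd : M.faceOf d ∈ z.domain) : M.faceOf d.symm ∉ z.domain := by
  intro hd'
  have h1 := M.mem_insideFaces_iff_of_mem_edges hG hcubic h
  match i, h1 with
  | none, h1 => exact h1.1 hd.1 hd'.1
  | some i, h1 =>
    refine hd.2 (Set.mem_iUnion.2 ⟨i, h1.2 fun h2 => hd'.2 (Set.mem_iUnion.2 ⟨i, h2⟩)⟩)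

/-- The inner side of any edge of C₀ belongs to the domain. -/
theorem domain_nonempty (hG : G.Connected) (hcubic : G.IsRegularOfDegree 3) :
    z.domain.Nonempty := by
  obtain ⟨e, he⟩ := List.exists_mem_of_ne_nil _
    (fun h => z.C₀.isCycle.not_nil (SimpleGraph.Walk.edges_eq_nil.1 h))
  obtain ⟨d, hd⟩ := G.exists_dart_edge_eq ⟨e, z.C₀.walk.edges_subset_edgeSet he⟩
  have hd : d.edge ∈ z.C₀.walk.edges := hd ▸ he
  have key : ∀ d : G.Dart, d.edge ∈ z.C₀.walk.edges → M.faceOf d ∈ M.insideFaces z.C₀ →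
      z.domain.Nonempty := fun d hd h => ⟨M.faceOf d, h, fun h1 => by
    obtain ⟨i, hi⟩ := Set.mem_iUnion.1 h1
    exact M.faceOf_notMem_insideFaces_of_subset hG hcubic (z.cycles_inside i) hd hi⟩
  by_cases h : M.faceOf d ∈ M.insideFaces z.C₀
  · exact key d hd h
  · refine key d.symm (by rwa [SimpleGraph.Dart.edge_symm]) ?_
    by_contra h1
    exact h ((M.mem_insideFaces_iff_of_mem_edges hG hcubic hd).2 h1)

theorem variablesDependent (hcubic : G.IsRegularOfDegree 3)
    (hbiconn : G.IsBiconnected) (hnonbip : ¬ G.IsBipartite) {S : Set V} (hS : z.verts ⊆ S) :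
    M.VariablesDependent S := by
  classical
  have hG := hbiconn.2.1
  obtain ⟨s, hs0, hs1⟩ := z.exists_face_function hG
  let l : M.Face → ZMod 3 := fun f => if f ∈ z.domain then (if s f = 0 then 1 else -1) else 0
  have hl : l M.outer = 0 := if_neg fun h => M.outer_notMem_insideFaces _ h.1
  rw [M.variablesDependent_iff]
  refine ⟨l, hl, ?_, ?_⟩
  -- No vertex with nonzero sum is exhibited; independence of the equations supplies one, since `l`
  -- is nonzero on the domain.
  · by_contra hcon
    push Not at hcon
    obtain ⟨f, hf⟩ := z.domain_nonempty hG hcubic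
    have h1 := congrFun (M.eq_zero_of_faceSum_eq_zero hcubic hbiconn hnonbip l hl hcon) f
    simp only [l, if_pos hf, Pi.zero_apply] at h1
    split_ifs at h1
    · exact absurd h1 (by decide)
    · exact absurd h1 (by decide)
  · intro v
    contrapose
    intro hv
    have hv : v ∉ z.verts := fun h => hv (hS h)
    by_cases hW : v ∈ z.W
    -- At a vertex of W the path edge has opposite signs on its sides, and the third face lies
    -- outside the domain: the sum is 1 - 1 + 0.
    · obtain ⟨i, hi⟩ := z.exists_mem_cycle hW
      rw [← z.image_pathEnd] at hW
      obtain ⟨p, -, rfl⟩ := mem_image.1 hW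
      obtain ⟨d, hd, hdP⟩ := (z.P p.1).exists_dart_fst_eq (z.pathEnd_mem p)
      rw [← hd] at hi ⊢
      obtain ⟨hD1, hD2⟩ := z.path_edge_mem_domain hdP
      have hcyc : ∀ i, d.edge ∉ (z.cycle i).walk.edges := fun i h =>
        z.notMem_domain_of_mem_cycle hG hcubic h hD1 hD2
      have hnext : (M.next d).edge ∈ (z.cycle i).walk.edges := by
        rcases (z.cycle i).two_of_three M.toRotationSystem hcubic hi with h | h | h
        · exact h.2.1
        · exact absurd h.1 (hcyc i)
        · exact absurd h.1 (hcyc i)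
      have hs := hs1 d hcyc ⟨_, hdP⟩
      rw [M.faceOf_symm] at hD2 hs
      have hD3 := z.notMem_domain_of_mem_cycle hG hcubic hnext hD2
      rw [M.faceOf_symm] at hD3
      rw [M.faceSum_eq hcubic hbiconn]
      simp only [l, if_pos hD1, if_pos hD2, if_neg hD3]
      generalize s (M.faceOf d) = a, s (M.faceOf (M.next d)) = b at hs ⊢
      revert a b
      decide
    · have hcyc : ∀ i, v ∉ (z.cycle i).verts := by
        intro i hi
        refine hv ⟨Or.inl ?_, hW⟩
        match i, hi with
        | none, hi => exact Or.inl hi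
        | some i, hi => exact Or.inr (Set.mem_iUnion.2 ⟨i, hi⟩)
      have hpath : ∀ j, v ∉ (z.P j).verts := fun j hj =>
        hv ⟨Or.inr (Set.mem_iUnion.2 ⟨j, hj⟩), hW⟩
      have hdeg : 0 < G.degree v := by rw [hcubic]; norm_num
      obtain ⟨w, hw⟩ := (G.degree_pos_iff_exists_adj v).1 hdeg
      have hstep : ∀ d : G.Dart, d.fst = v → l (M.faceOf (M.next d)) = l (M.faceOf d) := by
        rintro d rfl
        have h1 : ∀ i, d.edge ∉ (z.cycle i).walk.edges := fun i h =>
          hcyc i ((z.cycle i).fst_mem h)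
        have h2 := hs0 d h1 fun j h => hpath j ((z.P j).fst_mem h)
        have h3 := z.mem_domain_iff h1
        rw [M.faceOf_symm] at h2 h3
        simp only [l, h2, h3]
      rw [show v = (⟨(v, w), hw⟩ : G.Dart).fst from rfl, M.faceSum_eq hcubic hbiconn,
        hstep (M.next ⟨(v, w), hw⟩) (M.next_fst _), hstep ⟨(v, w), hw⟩ rfl]
      have h3 : ∀ a : ZMod 3, a + a + a = 0 := by decide
      exact h3 _

end PlaneEmbedding.ZebraData

/-! ### Pairing the leaves of a graph of maximal degree two -/

namespace GraphPath

variable {V : Type*} {G : SimpleGraph V} (P : GraphPath G)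

theorem not_nil : ¬ P.walk.Nil := SimpleGraph.Walk.not_nil_of_ne P.source_ne_target

theorem ncard_neighborSet_internal {v : V} (hv : v ∈ P.verts) (hs : v ≠ P.source)
    (ht : v ≠ P.target) : (P.walk.toSubgraph.neighborSet v).ncard = 2 := by
  obtain ⟨i, rfl, hi⟩ := SimpleGraph.Walk.mem_support_iff_exists_getVert.1 hv
  apply P.isPath.ncard_neighborSet_toSubgraph_internal_eq_two
  · rintro rfl
    exact hs (by simp)
  · refine lt_of_le_of_ne hi ?_
    rintro rfl
    exact ht (by simp)

/-- A path of a subgraph as a path of the graph. -/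
def mapLe {H : SimpleGraph V} (h : G ≤ H) : GraphPath H :=
  ⟨P.source, P.target, P.walk.mapLe h, P.isPath.mapLe h, P.source_ne_target⟩

theorem verts_mapLe {H : SimpleGraph V} (h : G ≤ H) : (P.mapLe h).verts = P.verts := by
  simp only [verts, mapLe, SimpleGraph.Walk.support_mapLe_eq_support]

theorem edges_mapLe {H : SimpleGraph V} (h : G ≤ H) :
    (P.mapLe h).walk.edges = P.walk.edges := P.walk.edges_mapLe_eq_edges h

variable [Finite V]

theorem ncard_neighborSet_eq_two (hdeg : ∀ v, (G.neighborSet v).ncard ≤ 2) {v : V}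
    (hv : v ∈ P.verts) (hs : v ≠ P.source) (ht : v ≠ P.target) :
    (G.neighborSet v).ncard = 2 := by
  refine le_antisymm (hdeg v) ?_
  rw [← P.ncard_neighborSet_internal hv hs ht]
  exact Set.ncard_le_ncard (P.walk.toSubgraph.neighborSet_subset v)

/-- A path between two leaves of a graph of maximal degree two exhausts its component. -/
theorem mem_verts_of_adj (hdeg : ∀ v, (G.neighborSet v).ncard ≤ 2)
    (hs : (G.neighborSet P.source).ncard = 1) (ht : (G.neighborSet P.target).ncard = 1) {v w : V}
    (hv : v ∈ P.verts) (hvw : G.Adj v w) : w ∈ P.verts := by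
  have hle : (G.neighborSet v).ncard ≤ (P.walk.toSubgraph.neighborSet v).ncard := by
    by_cases h1 : v = P.source
    · subst h1
      rw [P.isPath.neighborSet_toSubgraph_startpoint P.not_nil, Set.ncard_singleton, hs]
    by_cases h2 : v = P.target
    · subst h2
      rw [P.isPath.neighborSet_toSubgraph_endpoint P.not_nil, Set.ncard_singleton, ht]
    rw [P.ncard_neighborSet_internal hv h1 h2]
    exact hdeg v
  have heq := Set.eq_of_subset_of_ncard_le (P.walk.toSubgraph.neighborSet_subset v) hle
  have hw : w ∈ P.walk.toSubgraph.neighborSet v := heq ▸ hvw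
  exact P.walk.mem_verts_toSubgraph.1 (P.walk.toSubgraph.edge_vert hw.symm)

theorem mem_verts_of_reachable (hdeg : ∀ v, (G.neighborSet v).ncard ≤ 2)
    (hs : (G.neighborSet P.source).ncard = 1) (ht : (G.neighborSet P.target).ncard = 1) {v w : V}
    (hv : v ∈ P.verts) (hvw : G.Reachable v w) : w ∈ P.verts := by
  obtain ⟨p⟩ := hvw
  induction p with
  | nil => exact hv
  | cons h _ ih => exact ih (P.mem_verts_of_adj hdeg hs ht hv h)

end GraphPath

namespace SimpleGraph

variable {V : Type*} {H : SimpleGraph V}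

/-- In a graph of maximal degree two, the component of a leaf contains another leaf. -/
theorem exists_reachable_leaf [Finite V] (hdeg : ∀ v, (H.neighborSet v).ncard ≤ 2) {v : V}
    (hv : (H.neighborSet v).ncard = 1) :
    ∃ w, w ≠ v ∧ H.Reachable v w ∧ (H.neighborSet w).ncard = 1 := by
  classical
  have := Fintype.ofFinite V
  -- `K` keeps only the component of `v`, so the second odd vertex given by the handshake lemma is
  -- reachable from `v`.
  let K : SimpleGraph V :=
    { Adj := fun a b => H.Adj a b ∧ H.Reachable v a
      symm := ⟨fun a b h => ⟨h.1.symm, h.2.trans h.1.reachable⟩⟩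
      loopless := ⟨fun a h => h.1.ne rfl⟩ }
  have hK : ∀ w, K.degree w = (K.neighborSet w).ncard := fun w => by
    rw [← card_neighborSet_eq_degree, ← Nat.card_coe_set_eq, Nat.card_eq_fintype_card]
  have hreach : ∀ w, H.Reachable v w → K.neighborSet w = H.neighborSet w := by
    intro w hw
    ext u
    exact ⟨fun h => h.1, fun h => ⟨h, hw⟩⟩
  have hodd : Odd (K.degree v) := by
    rw [hK, hreach v (Reachable.refl v), hv]
    exact odd_one
  obtain ⟨w, hwv, hw⟩ := K.exists_ne_odd_degree_of_exists_odd_degree v hodd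
  have hvw : H.Reachable v w := by
    obtain ⟨u, hu⟩ := (K.degree_pos_iff_exists_adj w).1 hw.pos
    exact hu.2
  refine ⟨w, hwv, hvw, ?_⟩
  rw [hK, hreach w hvw] at hw
  have := hdeg w
  obtain ⟨k, hk⟩ := hw
  omega

/-- The leaves of a graph of maximal degree two are paired up by disjoint paths. -/
theorem exists_disjoint_paths [Finite V] (hdeg : ∀ v, (H.neighborSet v).ncard ≤ 2) :
    ∃ (m : ℕ) (P : Fin m → GraphPath H),
      (∀ j, (H.neighborSet (P j).source).ncard = 1) ∧
      (∀ j, (H.neighborSet (P j).target).ncard = 1) ∧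
      (∀ i j, i ≠ j → Disjoint (P i).verts (P j).verts) ∧
      {v | (H.neighborSet v).ncard = 1}.ncard = 2 * m := by
  classical
  have := Fintype.ofFinite V
  -- One path is chosen in each component that has a leaf. It exhausts the component, so its two
  -- ends are the only leaves there.
  let ι := {K : H.ConnectedComponent // ∃ v, H.connectedComponentMk v = K ∧
    (H.neighborSet v).ncard = 1}
  have hex : ∀ K : ι, ∃ P : GraphPath H, H.connectedComponentMk P.source = K.1 ∧
      (H.neighborSet P.source).ncard = 1 ∧ (H.neighborSet P.target).ncard = 1 := by
    rintro ⟨_, v, rfl, hv⟩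
    obtain ⟨w, hwv, ⟨p⟩, hw⟩ := exists_reachable_leaf hdeg hv
    exact ⟨⟨v, w, p.toPath.1, p.toPath.2, hwv.symm⟩, rfl, hv, hw⟩
  choose P hP hs ht using hex
  have hcomp : ∀ K v, v ∈ (P K).verts → H.connectedComponentMk v = K.1 := by
    intro K v hv
    rw [← hP K, ConnectedComponent.eq]
    exact ((P K).walk.takeUntil v hv).reachable.symm
  have hfin : Finite ι := inferInstance
  let e := Finite.equivFin ι
  let pend : Fin (Nat.card ι) × Bool → V := fun p =>
    if p.2 then (P (e.symm p.1)).target else (P (e.symm p.1)).source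
  have hpend : ∀ p, pend p ∈ (P (e.symm p.1)).verts := by
    intro p
    simp only [pend]
    split
    · exact Walk.end_mem_support _
    · exact Walk.start_mem_support _
  have hdisj : ∀ i j v, v ∈ (P (e.symm i)).verts → v ∈ (P (e.symm j)).verts → i = j := by
    intro i j v hi hj
    exact e.symm.injective (Subtype.ext ((hcomp _ v hi).symm.trans (hcomp _ v hj)))
  have hinj : Function.Injective pend := by
    rintro ⟨i, a⟩ ⟨j, b⟩ h
    have hij := hdisj i j _ (hpend (i, a)) (h ▸ hpend (j, b))
    subst hij
    have := (P (e.symm i)).source_ne_target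
    cases a <;> cases b
    · rfl
    · exact absurd h this
    · exact absurd h.symm this
    · rfl
  refine ⟨Nat.card ι, fun j => P (e.symm j), fun j => hs _, fun j => ht _, fun i j hij => ?_, ?_⟩
  · exact Set.disjoint_left.2 fun v hi hj => hij (hdisj i j v hi hj)
  · have hrange : {v | (H.neighborSet v).ncard = 1} = Set.range pend := by
      ext v
      constructor
      · intro hv
        let K : ι := ⟨H.connectedComponentMk v, v, rfl, hv⟩
        have hmem : v ∈ (P K).verts := (P K).mem_verts_of_reachable hdeg (hs K) (ht K)
          (Walk.start_mem_support _) (ConnectedComponent.eq.1 (hP K))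
        by_cases h1 : v = (P K).source
        · exact ⟨(e K, false), by simp [pend, h1]⟩
        by_cases h2 : v = (P K).target
        · exact ⟨(e K, true), by simp [pend, h2]⟩
        have h3 := (P K).ncard_neighborSet_eq_two hdeg hmem h1 h2
        rw [Set.mem_ofPred_eq, h3] at hv
        omega
      · rintro ⟨p, rfl⟩
        simp only [pend]
        split
        · exact ht _
        · exact hs _
    rw [hrange, ← Set.image_univ, Set.ncard_image_of_injective _ hinj, Set.ncard_univ]
    simp [mul_comm]

end SimpleGraph

/-! ### Graphs cut out by dart predicates -/

namespace SimpleGraph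

variable {V : Type*} {G : SimpleGraph V}

/-- The subgraph whose edges are selected by a symmetric predicate on the darts. -/
def dartGraph (P : G.Dart → Prop) (hP : ∀ d, P d → P d.symm) : SimpleGraph V where
  Adj u v := ∃ h : G.Adj u v, P ⟨(u, v), h⟩
  symm := ⟨fun _ _ h => ⟨h.1.symm, hP _ h.2⟩⟩
  loopless := ⟨fun _ h => h.1.ne rfl⟩

variable {P : G.Dart → Prop} {hP : ∀ d, P d → P d.symm}

theorem dartGraph_le : dartGraph P hP ≤ G := fun _ _ h => h.1

theorem dartGraph_adj {d : G.Dart} : (dartGraph P hP).Adj d.fst d.snd ↔ P d :=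
  ⟨fun h => h.2, fun h => ⟨d.adj, h⟩⟩

theorem ncard_neighborSet_dartGraph [Fintype V] [DecidableRel G.Adj] [DecidablePred P]
    (R : RotationSystem G) (hcubic : G.IsRegularOfDegree 3) (d : G.Dart) :
    ((dartGraph P hP).neighborSet d.fst).ncard = (if P d then 1 else 0) +
      (if P (R.next d) then 1 else 0) + (if P (R.next (R.next d)) then 1 else 0) :=
  R.ncard_of_cubic hcubic P d

/-- Every component of a graph all of whose degrees are `0` or `2` is a vertex or a cycle. -/
theorem IsCycles.exists_graphCycle [Finite V] (hB : (dartGraph P hP).IsCycles) {v : V}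
    (hv : ((dartGraph P hP).neighborSet v).Nonempty) :
    ∃ C : GraphCycle G, (∀ w, w ∈ C.verts ↔ (dartGraph P hP).connectedComponentMk w =
      (dartGraph P hP).connectedComponentMk v) ∧
      ∀ d : G.Dart, d.edge ∈ C.walk.edges ↔ (dartGraph P hP).connectedComponentMk d.fst =
        (dartGraph P hP).connectedComponentMk v ∧ P d := by
  obtain ⟨p, hp, hverts⟩ := hB.exists_cycle_toSubgraph_verts_eq_connectedComponentSupp
    (c := (dartGraph P hP).connectedComponentMk v) rfl hv
  have : (dartGraph P hP).LocallyFinite := fun _ => Fintype.ofFinite _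
  have hmem : ∀ w, w ∈ p.support ↔ (dartGraph P hP).connectedComponentMk w =
      (dartGraph P hP).connectedComponentMk v := by
    intro w
    rw [← Walk.mem_verts_toSubgraph, hverts]
    rfl
  refine ⟨⟨v, p.mapLe dartGraph_le, hp.mapLe _⟩, fun w => ?_, fun d => ?_⟩
  · rw [← hmem]
    simp [GraphCycle.verts]
  · rw [← hmem]
    simp only [Walk.edges_mapLe_eq_edges]
    have h1 : d.edge ∈ p.edges ↔ p.toSubgraph.Adj d.fst d.snd := by
      rw [← Walk.mem_edges_toSubgraph]
      rfl
    rw [h1]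
    constructor
    · intro h
      exact ⟨p.mem_verts_toSubgraph.1 (p.toSubgraph.edge_vert h), dartGraph_adj.1 h.adj_sub⟩
    · rintro ⟨h2, h3⟩
      rw [hp.adj_toSubgraph_iff_of_isCycles hB (p.mem_verts_toSubgraph.2 h2)]
      exact dartGraph_adj.2 h3

end SimpleGraph

/-! ### Boundary edges and sign changes of a weighting -/

namespace PlaneEmbedding

variable {V : Type*} {G : SimpleGraph V} (M : PlaneEmbedding G) (l : M.Face → ZMod 3)

/-- The support of a weighting of the faces is connected in the dual graph. -/
def IsDualConnected : Prop :=
  ∀ p : M.Face → Prop,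
    (∀ d, l (M.faceOf d) ≠ 0 → l (M.faceOf d.symm) ≠ 0 → (p (M.faceOf d) ↔ p (M.faceOf d.symm))) →
    ∀ f g, l f ≠ 0 → l g ≠ 0 → (p f ↔ p g)

/-- The edge of `d` lies on the boundary of the support of `l`. -/
abbrev IsBoundaryDart (d : G.Dart) : Prop := l (M.faceOf d) = 0 ↔ ¬ l (M.faceOf d.symm) = 0

/-- The two sides of the edge of `d` have opposite nonzero weights. -/
abbrev IsSignDart (d : G.Dart) : Prop :=
  l (M.faceOf d) ≠ 0 ∧ l (M.faceOf d) + l (M.faceOf d.symm) = 0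

theorem IsBoundaryDart.symm {d : G.Dart} (h : M.IsBoundaryDart l d) :
    M.IsBoundaryDart l d.symm := by
  simp only [IsBoundaryDart, SimpleGraph.Dart.symm_symm] at h ⊢
  tauto

theorem IsSignDart.symm {d : G.Dart} (h : M.IsSignDart l d) : M.IsSignDart l d.symm := by
  simp only [IsSignDart, SimpleGraph.Dart.symm_symm] at h ⊢
  refine ⟨fun h0 => h.1 ?_, by rw [add_comm]; exact h.2⟩
  rw [← h.2, h0, add_zero]

/-- The graph of the edges on the boundary of the support of `l`. -/
def boundaryGraph : SimpleGraph V :=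
  SimpleGraph.dartGraph (M.IsBoundaryDart l) fun _ => IsBoundaryDart.symm M l

/-- The graph of the edges whose sides have opposite nonzero weights. -/
def signGraph : SimpleGraph V :=
  SimpleGraph.dartGraph (M.IsSignDart l) fun _ => IsSignDart.symm M l

theorem signGraph_le : M.signGraph l ≤ G := SimpleGraph.dartGraph_le

variable [Fintype V] [DecidableRel G.Adj]

theorem exists_dart_fst_eq_of_cubic (hcubic : G.IsRegularOfDegree 3) (v : V) :
    ∃ d : G.Dart, d.fst = v := by
  have hdeg : 0 < G.degree v := by rw [hcubic]; norm_num
  obtain ⟨w, hw⟩ := (G.degree_pos_iff_exists_adj v).1 hdeg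
  exact ⟨⟨(v, w), hw⟩, rfl⟩

/-- Only the weights at the three corners matter. With x nonzero, (0,0,x) and (0,x,x) give a
boundary vertex with nonzero sum; (0,x,-x) a boundary vertex where a sign path ends, with zero sum;
(x,x,-x) an inner vertex of a sign curve with nonzero sum; (x,x,x) and (0,0,0) neither kind of edge.
-/
theorem local_structure (hcubic : G.IsRegularOfDegree 3) (hbiconn : G.IsBiconnected) (v : V) :
    (((M.boundaryGraph l).neighborSet v).ncard = 0 ∨
      ((M.boundaryGraph l).neighborSet v).ncard = 2) ∧
    ((M.signGraph l).neighborSet v).ncard ≤ 2 ∧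
    (((M.signGraph l).neighborSet v).ncard = 1 → ((M.boundaryGraph l).neighborSet v).ncard = 2) ∧
    (((M.boundaryGraph l).neighborSet v).ncard = 2 → ((M.signGraph l).neighborSet v).ncard ≠ 1 →
      M.faceSum l v ≠ 0) ∧
    (((M.signGraph l).neighborSet v).ncard = 2 → M.faceSum l v ≠ 0 ∧
      ((M.boundaryGraph l).neighborSet v).ncard = 0) := by
  obtain ⟨d, rfl⟩ := exists_dart_fst_eq_of_cubic hcubic v
  have h3 := (M.next_of_cubic hcubic d).2.2.1
  rw [boundaryGraph, signGraph, SimpleGraph.ncard_neighborSet_dartGraph M.toRotationSystem hcubic,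
    SimpleGraph.ncard_neighborSet_dartGraph M.toRotationSystem hcubic,
    M.faceSum_eq hcubic hbiconn]
  simp only [IsBoundaryDart, IsSignDart, M.faceOf_symm, h3]
  generalize l (M.faceOf d) = a, l (M.faceOf (M.next d)) = b,
    l (M.faceOf (M.next (M.next d))) = c
  revert a b c
  decide

theorem isCycles_boundaryGraph (hcubic : G.IsRegularOfDegree 3) (hbiconn : G.IsBiconnected) :
    (M.boundaryGraph l).IsCycles := by
  intro v hv
  rcases (M.local_structure l hcubic hbiconn v).1 with h | h
  · rw [Set.ncard_eq_zero] at h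
    exact absurd h hv.ne_empty
  · exact h

/-- Along a cycle of boundary edges, the number of sign changes is even. -/
theorem even_card_leaves (hcubic : G.IsRegularOfDegree 3)
    (K : (M.boundaryGraph l).ConnectedComponent) :
    Even {v | ((M.signGraph l).neighborSet v).ncard = 1 ∧
      (M.boundaryGraph l).connectedComponentMk v = K}.ncard := by
  classical
  -- `η` marks the boundary edges in `K` whose nonzero side has weight 1. The two boundary edges at
  -- a vertex differ in mark exactly at a leaf, and the total over darts is even because each edge
  -- has two.
  let η : G.Dart → ZMod 2 := fun d => if (M.IsBoundaryDart l d ∧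
    l (M.faceOf d) + l (M.faceOf d.symm) = 1) ∧ (M.boundaryGraph l).connectedComponentMk d.fst = K
    then 1 else 0
  have hη : ∀ d, η d.symm = η d := by
    intro d
    have hiff : (M.IsBoundaryDart l d.symm ∧
        l (M.faceOf d.symm) + l (M.faceOf d.symm.symm) = 1) ∧
          (M.boundaryGraph l).connectedComponentMk d.symm.fst = K ↔
        (M.IsBoundaryDart l d ∧
        l (M.faceOf d) + l (M.faceOf d.symm) = 1) ∧
          (M.boundaryGraph l).connectedComponentMk d.fst = K := by
      rw [SimpleGraph.Dart.symm_symm, add_comm (l (M.faceOf d.symm))]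
      have h1 : M.IsBoundaryDart l d.symm ↔ M.IsBoundaryDart l d :=
        ⟨fun h => IsBoundaryDart.symm M l h, fun h => IsBoundaryDart.symm M l h⟩
      rw [h1, and_assoc, and_assoc]
      refine and_congr_right fun h => and_congr_right fun _ => ?_
      have hadj : (M.boundaryGraph l).Adj d.fst d.snd := SimpleGraph.dartGraph_adj.2 h
      rw [SimpleGraph.ConnectedComponent.eq.2 hadj.reachable]
      rfl
    simp only [η, hiff]
  have hsum : ∑ d, η d = 0 := by
    refine sum_involution (fun d _ => d.symm) (fun d _ => ?_) (fun d _ _ => d.symm_ne)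
      (fun _ _ => mem_univ _) (fun d _ => d.symm_symm)
    rw [hη, CharTwo.add_self_eq_zero]
  have hvert : ∀ v, ∑ d with d.fst = v, η d = if ((M.signGraph l).neighborSet v).ncard = 1 ∧
      (M.boundaryGraph l).connectedComponentMk v = K then 1 else 0 := by
    intro v
    obtain ⟨d, rfl⟩ := exists_dart_fst_eq_of_cubic hcubic v
    have h3 := (M.next_of_cubic hcubic d).2.2.1
    rw [M.sum_darts_of_cubic hcubic]
    simp only [η, M.next_fst]
    by_cases hK : (M.boundaryGraph l).connectedComponentMk d.fst = K
    · simp only [hK, and_true]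
      rw [signGraph, SimpleGraph.ncard_neighborSet_dartGraph M.toRotationSystem hcubic]
      simp only [IsBoundaryDart, IsSignDart, M.faceOf_symm, h3]
      generalize l (M.faceOf d) = a, l (M.faceOf (M.next d)) = b,
        l (M.faceOf (M.next (M.next d))) = c
      revert a b c
      decide
    · simp [hK]
  rw [← sum_fiberwise (g := fun d : G.Dart => d.fst)] at hsum
  simp only [hvert] at hsum
  rw [sum_boole, ZMod.natCast_eq_zero_iff_even] at hsum
  rw [← Set.ncard_coe_finset] at hsum
  simpa using hsum

/-- A nonzero weighting can be restricted to a connected part of its support, without new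
nonzero vertex sums. -/
theorem exists_isDualConnected (hcubic : G.IsRegularOfDegree 3) (hbiconn : G.IsBiconnected)
    (hl : l M.outer = 0) (h0 : l ≠ 0) :
    ∃ l' : M.Face → ZMod 3, l' M.outer = 0 ∧ l' ≠ 0 ∧ M.IsDualConnected l' ∧
      ∀ v, M.faceSum l' v ≠ 0 → M.faceSum l v ≠ 0 := by
  classical
  obtain ⟨f₀, hf₀⟩ := Function.ne_iff.1 h0
  let r : M.Face → M.Face → Prop := fun f g =>
    ∃ d, M.faceOf d = f ∧ M.faceOf d.symm = g ∧ l g ≠ 0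
  let D : Set M.Face := {f | Relation.ReflTransGen r f₀ f}
  have hD : ∀ f ∈ D, l f ≠ 0 := by
    intro f hf
    rcases Relation.ReflTransGen.cases_tail hf with rfl | ⟨_, _, _, _, _, h⟩
    · exact hf₀
    · exact h
  have hstep : ∀ d, l (M.faceOf d.symm) ≠ 0 → M.faceOf d ∈ D → M.faceOf d.symm ∈ D :=
    fun d h1 h2 => Relation.ReflTransGen.tail h2 ⟨d, rfl, rfl, h1⟩
  let l' : M.Face → ZMod 3 := fun f => if f ∈ D then l f else 0
  have hl' : ∀ f, l' f ≠ 0 ↔ f ∈ D := by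
    intro f
    by_cases h : f ∈ D
    · simp [l', h, hD f h]
    · simp [l', h]
  refine ⟨l', ?_, Function.ne_iff.2 ⟨f₀, (hl' f₀).2 Relation.ReflTransGen.refl⟩, ?_, ?_⟩
  · by_contra h
    exact hD _ ((hl' _).1 h) hl
  · intro p hp
    have key : ∀ f, l' f ≠ 0 → (p f ↔ p f₀) := by
      intro f hf
      rw [hl'] at hf
      change Relation.ReflTransGen r f₀ f at hf
      induction hf with
      | refl => rfl
      | tail hab hbc ih =>
        rw [← ih]
        obtain ⟨d, rfl, rfl, hd⟩ := hbc
        exact (hp d ((hl' _).2 hab) ((hl' _).2 (hstep d hd hab))).symm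
    exact fun f g hf hg => (key f hf).trans (key g hg).symm
  · intro v
    obtain ⟨d, rfl⟩ := exists_dart_fst_eq_of_cubic hcubic v
    obtain ⟨-, -, h3, -⟩ := M.next_of_cubic hcubic d
    rw [M.faceSum_eq hcubic hbiconn, M.faceSum_eq hcubic hbiconn]
    -- Any two faces at a cubic vertex are adjacent. So if one of them is in `D`, all supported ones
    -- are, and the vertex sum is unchanged; otherwise the new sum is zero.
    have hnext : ∀ e, M.faceOf e ∈ D → l' (M.faceOf (M.next e)) = l (M.faceOf (M.next e)) := by
      intro e he
      by_cases h : l (M.faceOf (M.next e)) = 0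
      · rw [h]
        exact not_not.1 (mt (fun h' => hD _ ((hl' _).1 h')) (not_not.2 h))
      · rw [← M.faceOf_symm] at h ⊢
        exact if_pos (hstep e h he)
    have hprev : ∀ e, M.faceOf (M.next e) ∈ D → l' (M.faceOf e) = l (M.faceOf e) := by
      intro e he
      by_cases h : l (M.faceOf e) = 0
      · rw [h]
        exact not_not.1 (mt (fun h' => hD _ ((hl' _).1 h')) (not_not.2 h))
      · refine if_pos ?_
        have := hstep e.symm
        rw [SimpleGraph.Dart.symm_symm, M.faceOf_symm] at this
        exact this h he
    have hself : ∀ e, M.faceOf e ∈ D → l' (M.faceOf e) = l (M.faceOf e) := fun e he => if_pos he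
    have n1 := hnext d
    have n2 := hnext (M.next d)
    have n3 := hnext (M.next (M.next d))
    have p1 := hprev d
    have p2 := hprev (M.next d)
    have p3 := hprev (M.next (M.next d))
    rw [h3] at n3 p3
    by_cases c1 : M.faceOf d ∈ D
    · rw [hself _ c1, n1 c1, p3 c1]; exact id
    by_cases c2 : M.faceOf (M.next d) ∈ D
    · rw [hself _ c2, n2 c2, p1 c2]; exact id
    by_cases c3 : M.faceOf (M.next (M.next d)) ∈ D
    · rw [hself _ c3, n3 c3, p2 c3]; exact id
    · simp [l', c1, c2, c3]

end PlaneEmbedding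

/-! ### From a dependence to a zebra -/

namespace PlaneEmbedding

variable {V : Type*} {G : SimpleGraph V} (M : PlaneEmbedding G) (l : M.Face → ZMod 3)

variable {l} in
-- A step within the support never crosses a boundary edge, so the support lies wholly on one side
-- of C.
theorem mem_insideFaces_iff_of_isDualConnected (hconn : M.IsDualConnected l) {C : GraphCycle G}
    (hC : ∀ d : G.Dart, d.edge ∈ C.walk.edges → M.IsBoundaryDart l d) {f g : M.Face}
    (hf : l f ≠ 0) (hg : l g ≠ 0) : f ∈ M.insideFaces C ↔ g ∈ M.insideFaces C :=
  hconn (fun f => f ∈ M.insideFaces C) (fun d h1 h2 =>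
    M.mem_insideFaces_iff_of_notMem_edges fun h => h2 (not_not.1 (mt (hC d h).2 h1))) f g hf hg

variable [Fintype V] [DecidableRel G.Adj]

/-- The boundary of the support of a face weighting is a disjoint union of cycles. -/
theorem exists_boundary_cycles (hcubic : G.IsRegularOfDegree 3) (hbiconn : G.IsBiconnected) :
    ∃ (ι : Type) (_ : Finite ι) (K : ι → (M.boundaryGraph l).ConnectedComponent)
      (C : ι → GraphCycle G), Function.Injective K ∧
      (∀ i v, v ∈ (C i).verts ↔ (M.boundaryGraph l).connectedComponentMk v = K i) ∧
      (∀ i d, d.edge ∈ (C i).walk.edges ↔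
        (M.boundaryGraph l).connectedComponentMk d.fst = K i ∧ M.IsBoundaryDart l d) ∧
      ∀ v, ((M.boundaryGraph l).neighborSet v).Nonempty → ∃ i, v ∈ (C i).verts := by
  classical
  let J := {K : (M.boundaryGraph l).ConnectedComponent //
    ∃ v, (M.boundaryGraph l).connectedComponentMk v = K ∧
      ((M.boundaryGraph l).neighborSet v).Nonempty}
  have hex : ∀ K : J, ∃ C : GraphCycle G,
      (∀ v, v ∈ C.verts ↔ (M.boundaryGraph l).connectedComponentMk v = K.1) ∧
      ∀ d : G.Dart, d.edge ∈ C.walk.edges ↔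
        (M.boundaryGraph l).connectedComponentMk d.fst = K.1 ∧ M.IsBoundaryDart l d := by
    rintro ⟨_, v, rfl, hv⟩
    exact SimpleGraph.IsCycles.exists_graphCycle (M.isCycles_boundaryGraph l hcubic hbiconn) hv
  choose C hC1 hC2 using hex
  have : Finite J := inferInstance
  let e := Finite.equivFin J
  refine ⟨Fin (Nat.card J), inferInstance, fun i => (e.symm i).1, fun i => C (e.symm i),
    Subtype.val_injective.comp e.symm.injective, fun i => hC1 _, fun i => hC2 _, fun v hv => ?_⟩
  refine ⟨e ⟨_, v, rfl, hv⟩, ?_⟩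
  rw [hC1, Equiv.symm_apply_apply]

variable {l}

theorem exists_support_face_of_mem_cycle (hcubic : G.IsRegularOfDegree 3) {C : GraphCycle G}
    (hC : ∀ d : G.Dart, d.edge ∈ C.walk.edges → M.IsBoundaryDart l d) {v : V}
    (hv : v ∈ C.verts) : ∃ d : G.Dart, d.fst = v ∧ l (M.faceOf d) ≠ 0 := by
  obtain ⟨d, rfl⟩ := exists_dart_fst_eq_of_cubic hcubic v
  have key : ∀ e : G.Dart, e.fst = d.fst → e.edge ∈ C.walk.edges →
      ∃ d' : G.Dart, d'.fst = d.fst ∧ l (M.faceOf d') ≠ 0 := by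
    intro e he heC
    by_cases h : l (M.faceOf e) = 0
    · refine ⟨M.next e, (M.next_fst e).trans he, ?_⟩
      rw [← M.faceOf_symm]
      exact (hC e heC).1 h
    · exact ⟨e, he, h⟩
  rcases C.two_of_three M.toRotationSystem hcubic hv with h | h | h
  · exact key _ (M.next_fst d) h.2.1
  · exact key _ rfl h.1
  · exact key _ rfl h.1

/-- One of the boundary cycles of the support of `l` encloses any given face of the support. -/
theorem exists_mem_insideFaces (hcubic : G.IsRegularOfDegree 3) (hG : G.Connected)
    (hl : l M.outer = 0) {ι : Type} [Finite ι]
    {K : ι → (M.boundaryGraph l).ConnectedComponent}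
    {C : ι → GraphCycle G} (hK : Function.Injective K)
    (hv : ∀ i v, v ∈ (C i).verts ↔ (M.boundaryGraph l).connectedComponentMk v = K i)
    (hC : ∀ i d, d.edge ∈ (C i).walk.edges ↔
        (M.boundaryGraph l).connectedComponentMk d.fst = K i ∧ M.IsBoundaryDart l d)
    (hex : ∀ v, ((M.boundaryGraph l).neighborSet v).Nonempty → ∃ i, v ∈ (C i).verts)
    {f : M.Face} (hf : l f ≠ 0) : ∃ i, f ∈ M.insideFaces (C i) := by
  classical
  have := Fintype.ofFinite ι
  -- Crossing a boundary edge changes both membership in the support and the side of exactly one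
  -- cycle, so `g` is constant. It is zero on the outer face, hence an odd number of cycles enclose
  -- each supported face.
  let g : M.Face → ZMod 2 := fun f => (if l f = 0 then 0 else 1) +
    ∑ i, if f ∈ M.insideFaces (C i) then 1 else 0
  have hg : ∀ d, g (M.faceOf d) = g (M.faceOf d.symm) := by
    intro d
    by_cases hd : M.IsBoundaryDart l d
    · have hadj : (M.boundaryGraph l).Adj d.fst d.snd := SimpleGraph.dartGraph_adj.2 hd
      obtain ⟨i, hi⟩ := hex d.fst ⟨_, hadj⟩
      have hi' := (hv i _).1 hi
      have hne : ∀ j ∈ univ.erase i,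
          (if M.faceOf d ∈ M.insideFaces (C j) then (1 : ZMod 2) else 0) =
          if M.faceOf d.symm ∈ M.insideFaces (C j) then 1 else 0 := by
        intro j hj
        have hdj : d.edge ∉ (C j).walk.edges := fun h =>
          (mem_erase.1 hj).1 (hK (((hC j d).1 h).1.symm.trans hi'))
        simp only [M.mem_insideFaces_iff_of_notMem_edges hdj]
      have hdi := M.mem_insideFaces_iff_of_mem_edges hG hcubic ((hC i d).2 ⟨hi', hd⟩)
      simp only [g]
      rw [← add_sum_erase _ _ (mem_univ i), ← add_sum_erase _ _ (mem_univ i),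
        sum_congr rfl hne, ← add_assoc, ← add_assoc]
      congr 1
      by_cases h1 : l (M.faceOf d) = 0 <;> by_cases h2 : M.faceOf d ∈ M.insideFaces (C i)
      · simp [h1, hd.1 h1, h2, hdi.1 h2]
      · simp [h1, hd.1 h1, h2, not_not.1 (mt hdi.2 h2), CharTwo.add_self_eq_zero]
      · simp [h1, not_not.1 (mt hd.2 h1), h2, hdi.1 h2, CharTwo.add_self_eq_zero]
      · simp [h1, not_not.1 (mt hd.2 h1), h2, not_not.1 (mt hdi.2 h2)]
    · have hdi : ∀ i, M.faceOf d ∈ M.insideFaces (C i) ↔ M.faceOf d.symm ∈ M.insideFaces (C i) :=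
        fun i => M.mem_insideFaces_iff_of_notMem_edges fun h => hd ((hC i d).1 h).2
      have hd0 : l (M.faceOf d) = 0 ↔ l (M.faceOf d.symm) = 0 := by
        rw [IsBoundaryDart] at hd
        tauto
      simp only [g, hdi, hd0]
  have h1 := M.eq_of_faceOf_symm_eq hG g hg f M.outer
  by_contra hcon
  push Not at hcon
  simp [g, hf, hl, hcon, M.outer_notMem_insideFaces] at h1

/-- The cycles bound the support, W is the set of leaves of the sign graph, and the paths are its
components with leaves. Closed sign curves are simply dropped, since only containment of the zebra
is needed. -/
theorem exists_zebraData (hcubic : G.IsRegularOfDegree 3) (hbiconn : G.IsBiconnected)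
    (hl : l M.outer = 0) (h0 : l ≠ 0) (hconn : M.IsDualConnected l) :
    ∃ z : M.ZebraData, ∀ v ∈ z.verts, M.faceSum l v ≠ 0 := by
  classical
  have hG := hbiconn.2.1
  have hloc := M.local_structure l hcubic hbiconn
  obtain ⟨f₀, hf₀⟩ := Function.ne_iff.1 h0
  obtain ⟨ι, hι, K, C, hK, hv, hC, hex⟩ := M.exists_boundary_cycles l hcubic hbiconn
  obtain ⟨i₀, hi₀⟩ := M.exists_mem_insideFaces hcubic hG hl hK hv hC hex hf₀
  have hCb : ∀ i (d : G.Dart), d.edge ∈ (C i).walk.edges → M.IsBoundaryDart l d :=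
    fun i d h => ((hC i d).1 h).2
  have hface := fun i v => M.exists_support_face_of_mem_cycle hcubic (hCb i) (v := v)
  have hin : ∀ i f, l f ≠ 0 → (f ∈ M.insideFaces (C i) ↔ f₀ ∈ M.insideFaces (C i)) :=
    fun i f hf => M.mem_insideFaces_iff_of_isDualConnected hconn (hCb i) hf hf₀
  have hdisj : ∀ i j v, v ∈ (C i).verts → v ∈ (C j).verts → i = j := fun i j v h1 h2 =>
    hK (((hv i v).1 h1).symm.trans ((hv j v).1 h2))
  have hsub : ∀ i j, i ≠ j → f₀ ∈ M.insideFaces (C i) → (C j).verts ⊆ M.insideVerts (C i) := by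
    intro i j hij hi v hvj
    obtain ⟨d, hd, hd0⟩ := hface j v hvj
    exact ⟨fun h => hij (hdisj i j v h hvj), _, (hin i _ hd0).2 hi, d, hd, rfl⟩
  -- A second enclosing cycle would lie inside `C i₀` and also contain it, leaving the edges of `C
  -- i₀` with no inner side. So `C i₀` is the external cycle and all the others are internal.
  have hout : ∀ j, j ≠ i₀ → f₀ ∉ M.insideFaces (C j) := by
    intro j hj hj0
    obtain ⟨d, -, hd⟩ : ∃ d : G.Dart, d.fst = (C i₀).base ∧ d.edge ∈ (C i₀).walk.edges := by
      obtain ⟨d, hd⟩ := exists_dart_fst_eq_of_cubic hcubic (C i₀).base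
      have hmem : d.fst ∈ (C i₀).verts := hd ▸ SimpleGraph.Walk.start_mem_support _
      rcases (C i₀).two_of_three M.toRotationSystem hcubic hmem with h | h | h
      · exact ⟨_, (M.next_fst d).trans hd, h.2.1⟩
      · exact ⟨d, hd, h.1⟩
      · exact ⟨d, hd, h.1⟩
    have h1 := M.faceOf_notMem_insideFaces_of_subset hG hcubic (hsub i₀ j hj.symm hi₀) hd
    have h2 := M.faceOf_notMem_insideFaces_of_subset hG hcubic (hsub i₀ j hj.symm hi₀)
      (d := d.symm) (by rwa [SimpleGraph.Dart.edge_symm])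
    have h3 := M.insideFaces_subset (hsub j i₀ hj hj0)
    exact M.not_both_outside hG hd (fun h => h1 (h3 h)) (fun h => h2 (h3 h))
  let J := {i : ι // i ≠ i₀}
  let e := Finite.equivFin J
  have hdom : ∀ f, l f ≠ 0 →
      f ∈ M.insideFaces (C i₀) \ ⋃ i, M.insideFaces (C (e.symm i).1) := by
    intro f hf
    refine ⟨(hin _ _ hf).2 hi₀, fun h => ?_⟩
    obtain ⟨i, hi⟩ := Set.mem_iUnion.1 h
    exact hout _ (e.symm i).2 ((hin _ _ hf).1 hi)
  have hsdeg : ∀ v, ((M.signGraph l).neighborSet v).ncard ≤ 2 := fun v => (hloc v).2.1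
  obtain ⟨m, P, hs, ht, hP, hm⟩ := SimpleGraph.exists_disjoint_paths hsdeg
  let W : Finset V := univ.filter fun v => ((M.signGraph l).neighborSet v).ncard = 1
  have hmemW : ∀ v, v ∈ W ↔ ((M.signGraph l).neighborSet v).ncard = 1 := fun v => by simp [W]
  have hWcyc : ∀ v ∈ W, ∃ i, v ∈ (C i).verts := by
    intro v hvW
    apply hex
    rw [← Set.ncard_pos, (hloc v).2.2.1 ((hmemW v).1 hvW)]
    norm_num
  have hcycdeg : ∀ i v, v ∈ (C i).verts → ((M.boundaryGraph l).neighborSet v).ncard = 2 := by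
    intro i v hvi
    refine (hloc v).1.resolve_left fun h => ?_
    have h2 := (C i).ncard_incident hvi
    have hsubset : {w | ∃ _ : G.Adj v w, s(v, w) ∈ (C i).walk.edges} ⊆
        (M.boundaryGraph l).neighborSet v := by
      rintro w ⟨hvw, hw⟩
      exact ⟨hvw, hCb i ⟨(v, w), hvw⟩ hw⟩
    have := Set.ncard_le_ncard hsubset
    omega
  have hpathdeg : ∀ j v, v ∈ (P j).verts → v ∉ W →
      ((M.signGraph l).neighborSet v).ncard = 2 := by
    intro j v hvj hvW
    refine (P j).ncard_neighborSet_eq_two hsdeg hvj ?_ ?_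
    · rintro rfl
      exact hvW ((hmemW _).2 (hs j))
    · rintro rfl
      exact hvW ((hmemW _).2 (ht j))
  have heven : ∀ i, Even ((W : Set V) ∩ (C i).verts).ncard := by
    intro i
    convert M.even_card_leaves l hcubic (K i) using 2
    ext v
    simp [W, hv]
  let z : M.ZebraData :=
    { k := Nat.card J
      m := m
      C₀ := C i₀
      C := fun i => C (e.symm i).1
      W := W
      P := fun j => (P j).mapLe (M.signGraph_le l)
      cycles_inside := fun i => hsub i₀ _ (e.symm i).2.symm hi₀
      cycles_disjoint := fun i j hij => Set.disjoint_left.2 fun v h1 h2 =>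
        hij (e.symm.injective (Subtype.ext (hdisj _ _ v h1 h2)))
      W_subset := by
        intro v hvW
        obtain ⟨i, hi⟩ := hWcyc v hvW
        by_cases hii : i = i₀
        · exact Or.inl (hii ▸ hi)
        · exact Or.inr (Set.mem_iUnion.2 ⟨e ⟨i, hii⟩, by simpa using hi⟩)
      even_W₀ := heven i₀
      even_W := fun i => heven _
      card_W := by
        rw [← hm, ← Set.ncard_coe_finset]
        simp [W]
      source_mem := fun j => (hmemW _).2 (hs j)
      target_mem := fun j => (hmemW _).2 (ht j)
      paths_disjoint := by
        intro i j hij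
        rw [GraphPath.verts_mapLe, GraphPath.verts_mapLe]
        exact hP i j hij
      path_verts := by
        intro j v hvj
        rw [GraphPath.verts_mapLe] at hvj
        by_cases hvW : v ∈ W
        · exact Or.inr hvW
        left
        have h2 := hpathdeg j v hvj hvW
        have hb := ((hloc v).2.2.2.2 h2).2
        have hnot : ∀ i, v ∉ (C i).verts := fun i hi => by
          have := hcycdeg i v hi
          omega
        obtain ⟨w, hw⟩ : ((M.signGraph l).neighborSet v).Nonempty := by
          rw [← Set.ncard_pos, h2]
          norm_num
        obtain ⟨hvw, hsign, -⟩ := hw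
        have hd := hdom _ hsign
        refine ⟨⟨hnot i₀, _, hd.1, ⟨(v, w), hvw⟩, rfl, rfl⟩, fun h => ?_⟩
        obtain ⟨i, hi | hi⟩ := Set.mem_iUnion.1 h
        · exact hnot _ hi
        · exact hd.2 (Set.mem_iUnion.2 ⟨i, M.faceOf_mem_of_mem_insideVerts
            (d := ⟨(v, w), hvw⟩) hi⟩)
      path_edges := by
        intro j d hd
        have hd : d.edge ∈ (P j).walk.edges := by
          rw [← GraphPath.edges_mapLe (h := M.signGraph_le l)]
          exact List.mem_map_of_mem hd
        have hadj : (M.signGraph l).Adj d.fst d.snd := (P j).walk.edges_subset_edgeSet hd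
        have hsign : M.IsSignDart l d := SimpleGraph.dartGraph_adj.1 hadj
        exact ⟨hdom _ hsign.1, hdom _ (IsSignDart.symm M l hsign).1⟩ }
  refine ⟨z, ?_⟩
  rintro v ⟨hvz, hvW⟩
  have hvW : v ∉ W := hvW
  have hcyc : ∀ i, v ∈ (C i).verts → M.faceSum l v ≠ 0 := fun i hi =>
    (hloc v).2.2.2.1 (hcycdeg i v hi) fun h => hvW ((hmemW v).2 h)
  rcases hvz with (hvz | hvz) | hvz
  · exact hcyc _ hvz
  · obtain ⟨i, hi⟩ := Set.mem_iUnion.1 hvz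
    exact hcyc _ hi
  · obtain ⟨j, hj⟩ := Set.mem_iUnion.1 hvz
    have hj : v ∈ (P j).verts := (P j).verts_mapLe (M.signGraph_le l) ▸ hj
    exact ((hloc v).2.2.2.2 (hpathdeg j v hj hvW)).1

theorem variablesDependent_iff_exists_isZebra (hcubic : G.IsRegularOfDegree 3)
    (hbiconn : G.IsBiconnected) (hnonbip : ¬ G.IsBipartite) (S : Set V) :
    M.VariablesDependent S ↔ ∃ Z : Set V, M.IsZebra Z ∧ Z ⊆ S := by
  constructor
  · intro h
    obtain ⟨l, hl, ⟨v, hv⟩, hS⟩ := (M.variablesDependent_iff S).1 h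
    have h0 : l ≠ 0 := by
      rintro rfl
      exact hv (sum_eq_zero fun _ _ => rfl)
    obtain ⟨l', hl', h0', hconn, hsum⟩ := M.exists_isDualConnected l hcubic hbiconn hl h0
    obtain ⟨z, hz⟩ := M.exists_zebraData hcubic hbiconn hl' h0' hconn
    exact ⟨z.verts, ⟨z, rfl⟩, fun v hv => hS v (hsum v (hz v hv))⟩
  · rintro ⟨_, ⟨z, rfl⟩, hZ⟩
    exact z.variablesDependent hcubic hbiconn hnonbip hZ

end PlaneEmbedding

theorem theorem2 {V : Type*} [Fintype V] (G : SimpleGraph V) [DecidableRel G.Adj] (n : ℕ)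
    (hcard : Fintype.card V = 2 * n) (hcubic : G.IsRegularOfDegree 3)
    (hbiconn : G.IsBiconnected) (hnonbip : ¬ G.IsBipartite) (M : PlaneEmbedding G) :
    (LinearIndependent (ZMod 3) M.mainMatrix.row ∧ M.mainMatrix.rank = n + 1) ∧
    (∀ S : Set V, M.VariablesDependent S ↔ ∃ Z : Set V, M.IsZebra Z ∧ Z ⊆ S) ∧
    (∀ S : Set V, S.ncard = n → M.VariablesDependent S ∧ ∃ Z : Set V, M.IsZebra Z ∧ Z ⊆ S) := by
  have hiff := M.variablesDependent_iff_exists_isZebra hcubic hbiconn hnonbip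
  refine ⟨⟨M.linearIndependent_mainMatrix_row hcubic hbiconn hnonbip,
    M.rank_mainMatrix hcard hcubic hbiconn hnonbip⟩, hiff, fun S hS => ?_⟩
  have hdep := M.variablesDependent_of_ncard_eq hcard hcubic hbiconn hnonbip S hS
  exact ⟨hdep, (hiff S).1 hdep⟩
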